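/- Let $m\ge 1$ be a squarefree integer and let $K=\mathbb{Q}(\sqrt{-m})\subset\mathbb{C}$ be the corresponding imaginary quadratic field, with ring of integers $\mathcal{O}_K$ and discriminant $d_K$. Put $\Gamma_K=SL_2(\mathcal{O}_K)\le SL_2(\mathbb{C})$ and $\omega=m+\sqrt{-m}$, where $\sqrt{-m}=i\sqrt{m}$. For every positive squarefree divisor $d$ of $d_K$ there are integers $u,v$ with $ud-v\,\omega\overline{\omega}/d=1$; for any such choice put $$V_d=\frac{1}{\sqrt d}\begin{pmatrix} ud & v\omega\\ \overline{\omega} & d\end{pmatrix}\in SL_2(\mathbb{C}).$$ Then among the discrete subgroups of $SL_2(\mathbb{C})$ that contain $\Gamma_K$ there is a greatest one with respect to inclusion, the maximal discrete extension $\Gamma_K^*$ of $\Gamma_K$ in $SL_2(\mathbb{C})$, and, for every choice of the integers $u,v$ (depending on $d$) as above, $$\Gamma_K^*=\bigcup_{\substack{d\mid d_K,\ d>0\\ d\ \text{squarefree}}}\Gamma_K V_d .$$ -/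

import Mathlib

open scoped MatrixGroups NumberField

noncomputable section

/-- The square root `√(-m) = i√m` in the upper half of the imaginary axis. -/
def sqrtNeg (m : ℕ) : ℂ := (Real.sqrt m : ℂ) * Complex.I

theorem sqrtNeg_sq (m : ℕ) : sqrtNeg m ^ 2 = -(m : ℂ) := by
  have h : ((Real.sqrt m : ℝ) : ℂ) ^ 2 = (m : ℂ) := by
    exact_mod_cast Real.sq_sqrt (Nat.cast_nonneg (α := ℝ) m)
  rw [sqrtNeg, mul_pow, h, Complex.I_sq]
  ring

/-- The field `ℚ(√(-m))` as a subfield of `ℂ`. -/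
def imagQuadField (m : ℕ) : IntermediateField ℚ ℂ :=
  IntermediateField.adjoin ℚ {sqrtNeg m}

instance imagQuadFieldNumberField (m : ℕ) : NumberField (imagQuadField m) where
  to_charZero := inferInstance
  to_finiteDimensional := by
    have h : IsIntegral ℚ (sqrtNeg m) := by
      refine IsIntegral.of_pow (n := 2) (by norm_num) ?_
      rw [sqrtNeg_sq]
      have := (isIntegral_algebraMap (R := ℚ) (A := ℂ) (x := -(m : ℚ)))
      simpa using this
    exact IntermediateField.adjoin.finiteDimensional h

/-- The group `SL₂(𝓞_K)`, `K = ℚ(√(-m))`, as a subgroup of `SL₂(ℂ)`. -/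
def bianchiGroup (m : ℕ) : Subgroup SL(2, ℂ) :=
  (Matrix.SpecialLinearGroup.map (n := Fin 2)
    (algebraMap (𝓞 (imagQuadField m)) ℂ)).range

/-- `Γ'` is the maximal discrete extension of `Γ` in `SL₂(ℂ)`: the greatest element among the
discrete subgroups of `SL₂(ℂ)` that contain `Γ`. -/
def IsMaximalDiscreteExtension (Γ Γ' : Subgroup SL(2, ℂ)) : Prop :=
  IsGreatest {G : Subgroup SL(2, ℂ) | Γ ≤ G ∧ DiscreteTopology G} Γ'

/-- The (positive) squarefree divisors of the discriminant of `ℚ(√(-m))`. -/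
abbrev SqfreeDiscrDivisor (m : ℕ) : Type :=
  {d : ℕ // Squarefree d ∧ (d : ℤ) ∣ NumberField.discr (imagQuadField m)}

/-- `ω = m + √(-m)`. -/
def omega (m : ℕ) : ℂ := (m : ℂ) + sqrtNeg m

/-- The condition `u d - v ω ω̄ / d = 1` on integers `u`, `v`. -/
def IsBezoutPair (m d : ℕ) (u v : ℤ) : Prop :=
  (u : ℂ) * d - v * (omega m * starRingEnd ℂ (omega m)) / d = 1

/-- The generalized Atkin-Lehner involution
`V_d = (1/√d) (u d, v ω; ω̄, d)`, an element of `SL₂(ℂ)`. -/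
def atkinLehner (m d : ℕ) (u v : ℤ) (hd : d ≠ 0) (h : IsBezoutPair m d u v) : SL(2, ℂ) :=
  ⟨(1 / (Real.sqrt d : ℂ)) •
      !![(u : ℂ) * d, v * omega m;
         starRingEnd ℂ (omega m), (d : ℂ)], by
    have hd' : (d : ℂ) ≠ 0 := by exact_mod_cast hd
    have hs : ((Real.sqrt d : ℝ) : ℂ) ^ 2 = (d : ℂ) := by
      exact_mod_cast Real.sq_sqrt (Nat.cast_nonneg (α := ℝ) d)
    have h' : (u : ℂ) * d * d - v * omega m * starRingEnd ℂ (omega m) = d := by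
      unfold IsBezoutPair at h
      field_simp at h
      linear_combination h
    rw [Matrix.det_smul, Matrix.det_fin_two_of, h', Fintype.card_fin, div_pow, hs]
    field_simp⟩

end

/-! The maximal extension is realised as `integralProductGroup`: the matrices of determinant one
whose entries have all pairwise products in 𝓞_K. It contains Γ_K, and it is discrete because the
squares of its entries lie in 𝓞_K, which has no nonzero element of absolute value less than 1.

Coset decomposition. Fix g in this group and a nonzero entry e. The ideal generated by e times the
entries of g has square (e²), because det g = 1. So e² has square norm, and in a quadratic field
this makes e² a rational times a square of K. Hence √r·g has entries in K for some squarefree r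
(`exists_squarefree_sqrt_mul_mem`). These entries are integers whose squares are divisible by r, and
their determinant is r. A trace form argument then gives r ∣ d_K (`dvd_discr_of_sqrt_mul_mem`). As
√r·V_r also has entries in K, so does g V_r⁻¹, which therefore lies in Γ_K.

Maximality. Let G be discrete with Γ_K ≤ G. Dirichlet approximation produces conjugates in G of the
unit translation that stay bounded and would accumulate unless the columns of elements of G are
proportional to vectors over K (`exists_column_relation`). Hence products of entries lie in K
(`entry_mul_entry_mem`). Elements of G with entries in K are integral: 𝓞_K has finite index in the
translations of G, which bounds how divisible a bottom row can be, whereas a non-integral entry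
would produce bottom rows arbitrarily small at some prime (`le_range_map_of_bottom_row`).
Conjugating the unit translation by g ∈ G gives a matrix over K whose off-diagonal entries are, up
to sign, the squares of the first column of g. So these squares are integral. -/

/-- The ring of integers of `ℚ(√(-m))` as a subring of `ℂ`. -/
noncomputable def intRing (m : ℕ) : Subring ℂ := (algebraMap (𝓞 (imagQuadField m)) ℂ).range

theorem mem_intRing_iff {m : ℕ} {z : ℂ} :
    z ∈ intRing m ↔ z ∈ imagQuadField m ∧ IsIntegral ℤ z := by
  constructor
  · rintro ⟨x, rfl⟩
    exact ⟨(x : imagQuadField m).2, (x.2 : IsIntegral ℤ (x : imagQuadField m)).map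
      ((imagQuadField m).val.restrictScalars ℤ)⟩
  · rintro ⟨h, hi⟩
    have h2 : IsIntegral ℤ (⟨z, h⟩ : imagQuadField m) :=
      (isIntegral_algHom_iff ((imagQuadField m).val.restrictScalars ℤ)
        Subtype.val_injective).1 hi
    exact ⟨⟨⟨z, h⟩, h2⟩, rfl⟩

theorem mem_intRing_of_sq {m : ℕ} {z : ℂ} (hz : z ∈ imagQuadField m) (h : z ^ 2 ∈ intRing m) :
    z ∈ intRing m :=
  mem_intRing_iff.2 ⟨hz, IsIntegral.of_pow (n := 2) (by norm_num) (mem_intRing_iff.1 h).2⟩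

theorem mem_bianchiGroup_iff {m : ℕ} {g : SL(2, ℂ)} :
    g ∈ bianchiGroup m ↔ ∀ i j, g i j ∈ intRing m := by
  constructor
  · rintro ⟨x, rfl⟩ i j
    exact ⟨x i j, rfl⟩
  · intro h
    choose f hf using h
    have hinj : Function.Injective (algebraMap (𝓞 (imagQuadField m)) ℂ) :=
      fun x y hxy => by
        apply NumberField.RingOfIntegers.ext
        exact Subtype.ext hxy
    refine ⟨⟨Matrix.of f, ?_⟩, ?_⟩
    · apply hinj
      have := g.2
      rw [Matrix.det_fin_two] at this ⊢
      simp only [Matrix.of_apply, map_sub, map_mul, hf, map_one]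
      exact this
    · ext i j
      exact hf i j

/-! ### Rational coordinates, trace and norm in K -/

theorem sqrtNeg_re (m : ℕ) : (sqrtNeg m).re = 0 := by simp [sqrtNeg]

theorem sqrtNeg_im (m : ℕ) : (sqrtNeg m).im = Real.sqrt m := by simp [sqrtNeg]

theorem sqrtNeg_mem (m : ℕ) : sqrtNeg m ∈ imagQuadField m :=
  IntermediateField.mem_adjoin_simple_self ℚ _

theorem ratCast_mem_imagQuadField (m : ℕ) (q : ℚ) : (q : ℂ) ∈ imagQuadField m :=
  (imagQuadField m).algebraMap_mem q

theorem sqrtNeg_mem_intRing (m : ℕ) : sqrtNeg m ∈ intRing m := by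
  refine mem_intRing_of_sq (sqrtNeg_mem m) ?_
  rw [sqrtNeg_sq]
  exact neg_mem (natCast_mem _ m)

theorem mem_imagQuadField_iff {m : ℕ} {z : ℂ} :
    z ∈ imagQuadField m ↔ ∃ a b : ℚ, z = a + b * sqrtNeg m := by
  constructor
  · intro h
    induction h using IntermediateField.adjoin_induction with
    | mem x hx => exact ⟨0, 1, by simp_all⟩
    | algebraMap x => exact ⟨x, 0, by simp⟩
    | add x y _ _ hx hy =>
      obtain ⟨a, b, rfl⟩ := hx
      obtain ⟨c, d, rfl⟩ := hy
      exact ⟨a + c, b + d, by push_cast; ring⟩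
    | mul x y _ _ hx hy =>
      obtain ⟨a, b, rfl⟩ := hx
      obtain ⟨c, d, rfl⟩ := hy
      exact ⟨a * c - m * b * d, a * d + b * c, by
        push_cast; linear_combination (b * d : ℂ) * sqrtNeg_sq m⟩
    | inv x _ hx =>
      obtain ⟨a, b, rfl⟩ := hx
      by_cases h0 : (a : ℂ) + b * sqrtNeg m = 0
      · exact ⟨0, 0, by simp [h0]⟩
      have h1 : (a : ℂ) - b * sqrtNeg m ≠ 0 := by
        intro h
        apply h0
        have h2 := congrArg (starRingEnd ℂ) h
        simpa [sqrtNeg] using h2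
      have h2 : (a : ℂ) ^ 2 + m * b ^ 2 ≠ 0 := by
        have : (a : ℂ) ^ 2 + m * b ^ 2 = (a + b * sqrtNeg m) * (a - b * sqrtNeg m) := by
          linear_combination (b ^ 2 : ℂ) * sqrtNeg_sq m
        rw [this]
        exact mul_ne_zero h0 h1
      refine ⟨a / (a ^ 2 + m * b ^ 2), -b / (a ^ 2 + m * b ^ 2), ?_⟩
      push_cast
      apply inv_eq_of_mul_eq_one_right
      rw [← div_self h2]
      linear_combination (-(b : ℂ) ^ 2 / (a ^ 2 + m * b ^ 2)) * sqrtNeg_sq m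
  · rintro ⟨a, b, rfl⟩
    exact add_mem (ratCast_mem_imagQuadField m a)
      (mul_mem (ratCast_mem_imagQuadField m b) (sqrtNeg_mem m))

theorem normSq_add_mul_sqrtNeg (m : ℕ) (a b : ℚ) :
    Complex.normSq (a + b * sqrtNeg m) = a ^ 2 + m * b ^ 2 := by
  have h : Real.sqrt m ^ 2 = m := Real.sq_sqrt (Nat.cast_nonneg m)
  have h1 : ((a : ℂ) + b * sqrtNeg m).re = a := by simp [sqrtNeg_re]
  have h2 : ((a : ℂ) + b * sqrtNeg m).im = b * Real.sqrt m := by simp [sqrtNeg_im]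
  rw [Complex.normSq_apply, h1, h2]
  linear_combination (b : ℝ) ^ 2 * h

/-- `√(-m)` as an element of `ℚ(√(-m))`. -/
noncomputable def sqrtNegGen (m : ℕ) : imagQuadField m := ⟨sqrtNeg m, sqrtNeg_mem m⟩

theorem sqrtNegGen_mul_self (m : ℕ) : sqrtNegGen m * sqrtNegGen m = -(m : imagQuadField m) := by
  apply Subtype.ext
  have := sqrtNeg_sq m
  rw [pow_two] at this
  simpa [sqrtNegGen] using this

theorem exists_rat_coords {m : ℕ} (x : imagQuadField m) :
    ∃ a b : ℚ, x = algebraMap ℚ _ a + algebraMap ℚ _ b * sqrtNegGen m := by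
  obtain ⟨a, b, h⟩ := mem_imagQuadField_iff.1 x.2
  exact ⟨a, b, Subtype.ext (by simpa [sqrtNegGen] using h)⟩

theorem linearIndependent_one_sqrtNegGen {m : ℕ} (hm : m ≠ 0) :
    LinearIndependent ℚ ![(1 : imagQuadField m), sqrtNegGen m] := by
  rw [LinearIndependent.pair_iff]
  intro a b h
  have h1 : ((a : ℂ) + b * sqrtNeg m) = 0 := by
    have := congrArg Subtype.val h
    simpa [sqrtNegGen, Algebra.smul_def] using this
  have h2 := congrArg Complex.re h1
  have h3 := congrArg Complex.im h1
  simp [sqrtNeg_re, sqrtNeg_im] at h2 h3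
  exact ⟨h2, h3.resolve_right hm⟩

/-- The basis `1, √(-m)` of `ℚ(√(-m))`. -/
noncomputable def sqrtNegBasis {m : ℕ} (hm : m ≠ 0) :
    Module.Basis (Fin 2) ℚ (imagQuadField m) :=
  Module.Basis.mk (linearIndependent_one_sqrtNegGen hm) (by
    rintro x -
    obtain ⟨a, b, rfl⟩ := exists_rat_coords x
    rw [Matrix.range_cons, Matrix.range_cons, Matrix.range_empty, Set.union_empty,
      Set.singleton_union, Submodule.mem_span_pair]
    exact ⟨a, b, by simp [Algebra.smul_def]⟩)

theorem sqrtNegBasis_zero {m : ℕ} (hm : m ≠ 0) : sqrtNegBasis hm 0 = 1 := by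
  simp [sqrtNegBasis]

theorem sqrtNegBasis_one {m : ℕ} (hm : m ≠ 0) : sqrtNegBasis hm 1 = sqrtNegGen m := by
  simp [sqrtNegBasis]

theorem sqrtNegBasis_repr {m : ℕ} (hm : m ≠ 0) (a b : ℚ) :
    ((sqrtNegBasis hm).repr (algebraMap ℚ _ a + algebraMap ℚ _ b * sqrtNegGen m) : Fin 2 → ℚ) =
      ![a, b] := by
  have : algebraMap ℚ _ a + algebraMap ℚ _ b * sqrtNegGen m =
      a • sqrtNegBasis hm 0 + b • sqrtNegBasis hm 1 := by
    rw [sqrtNegBasis_zero, sqrtNegBasis_one, Algebra.smul_def, Algebra.smul_def, mul_one]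
  rw [this]
  ext i
  fin_cases i <;> simp

theorem leftMulMatrix_sqrtNegBasis {m : ℕ} (hm : m ≠ 0) (a b : ℚ) :
    Algebra.leftMulMatrix (sqrtNegBasis hm)
      (algebraMap ℚ _ a + algebraMap ℚ _ b * sqrtNegGen m) = !![a, -(m * b); b, a] := by
  have h0 : (algebraMap ℚ _ a + algebraMap ℚ _ b * sqrtNegGen m) * sqrtNegBasis hm 0 =
      algebraMap ℚ _ a + algebraMap ℚ _ b * sqrtNegGen m := by
    rw [sqrtNegBasis_zero, mul_one]
  have h1 : (algebraMap ℚ _ a + algebraMap ℚ _ b * sqrtNegGen m) * sqrtNegBasis hm 1 =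
      algebraMap ℚ _ (-(m * b)) + algebraMap ℚ _ a * sqrtNegGen m := by
    rw [sqrtNegBasis_one, map_neg, map_mul, map_natCast]
    linear_combination (algebraMap ℚ (imagQuadField m) b) * sqrtNegGen_mul_self m
  ext i j
  rw [Algebra.leftMulMatrix_eq_repr_mul]
  fin_cases j
  · have := congrFun (sqrtNegBasis_repr hm a b) i
    rw [← h0] at this
    refine this.trans ?_
    fin_cases i <;> rfl
  · have := congrFun (sqrtNegBasis_repr hm (-(m * b)) a) i
    rw [← h1] at this
    refine this.trans ?_
    fin_cases i <;> rfl

theorem trace_sqrtNeg_coords {m : ℕ} (hm : m ≠ 0) (a b : ℚ) :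
    Algebra.trace ℚ (imagQuadField m)
      (algebraMap ℚ _ a + algebraMap ℚ _ b * sqrtNegGen m) = 2 * a := by
  rw [Algebra.trace_eq_matrix_trace (sqrtNegBasis hm), leftMulMatrix_sqrtNegBasis,
    Matrix.trace_fin_two_of]
  ring

theorem norm_sqrtNeg_coords {m : ℕ} (hm : m ≠ 0) (a b : ℚ) :
    Algebra.norm ℚ (algebraMap ℚ (imagQuadField m) a + algebraMap ℚ _ b * sqrtNegGen m) =
      a ^ 2 + m * b ^ 2 := by
  rw [Algebra.norm_eq_matrix_det (sqrtNegBasis hm), leftMulMatrix_sqrtNegBasis,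
    Matrix.det_fin_two_of]
  ring

theorem finrank_imagQuadField {m : ℕ} (hm : m ≠ 0) :
    Module.finrank ℚ (imagQuadField m) = 2 := by
  rw [Module.finrank_eq_card_basis (sqrtNegBasis hm), Fintype.card_fin]

theorem normSq_eq_norm {m : ℕ} (hm : m ≠ 0) (x : 𝓞 (imagQuadField m)) :
    Complex.normSq ((x : imagQuadField m) : ℂ) = (Algebra.norm ℤ x : ℤ) := by
  obtain ⟨a, b, h⟩ := exists_rat_coords (x : imagQuadField m)
  have h1 : ((Algebra.norm ℤ x : ℤ) : ℚ) = a ^ 2 + m * b ^ 2 := by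
    rw [Algebra.coe_norm_int, h, norm_sqrtNeg_coords hm]
  have h2 : ((x : imagQuadField m) : ℂ) = a + b * sqrtNeg m := by
    rw [h]; simp [sqrtNegGen]
  rw [h2, normSq_add_mul_sqrtNeg]
  exact_mod_cast h1.symm

theorem trace_mul_self_eq {m : ℕ} (hm : m ≠ 0) (x : 𝓞 (imagQuadField m)) :
    Algebra.trace ℤ _ (x * x) = (Algebra.trace ℤ _ x) ^ 2 - 2 * Algebra.norm ℤ x := by
  obtain ⟨a, b, h⟩ := exists_rat_coords (x : imagQuadField m)
  have h1 : ((x * x : 𝓞 (imagQuadField m)) : imagQuadField m) =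
      algebraMap ℚ _ (a ^ 2 - m * b ^ 2) + algebraMap ℚ _ (2 * a * b) * sqrtNegGen m := by
    rw [show ((x * x : 𝓞 (imagQuadField m)) : imagQuadField m) = x * x from
      map_mul (algebraMap _ _) x x, h]
    simp only [map_sub, map_mul, map_pow, map_natCast, map_ofNat]
    linear_combination (algebraMap ℚ (imagQuadField m) b) ^ 2 * sqrtNegGen_mul_self m
  have h2 : ((Algebra.trace ℤ _ (x * x) : ℤ) : ℚ) =
      ((Algebra.trace ℤ _ x) ^ 2 - 2 * Algebra.norm ℤ x : ℤ) := by
    push_cast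
    rw [Algebra.coe_trace_int, Algebra.coe_trace_int, Algebra.coe_norm_int, h1, h,
      trace_sqrtNeg_coords hm, trace_sqrtNeg_coords hm, norm_sqrtNeg_coords hm]
    ring
  exact_mod_cast h2

/-- Cayley–Hamilton in degree two. -/
theorem mul_self_eq_trace_mul_sub_norm {m : ℕ} (hm : m ≠ 0) (x : 𝓞 (imagQuadField m)) :
    x * x = (Algebra.trace ℤ _ x) * x - (Algebra.norm ℤ x : ℤ) := by
  obtain ⟨a, b, h⟩ := exists_rat_coords (x : imagQuadField m)
  apply NumberField.RingOfIntegers.ext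
  have h1 : ((Algebra.trace ℤ _ x : ℤ) : imagQuadField m) = algebraMap ℚ _ (2 * a) := by
    rw [← trace_sqrtNeg_coords hm a b, ← h, ← Algebra.coe_trace_int]; simp
  have h2 : ((Algebra.norm ℤ x : ℤ) : imagQuadField m) = algebraMap ℚ _ (a ^ 2 + m * b ^ 2) := by
    rw [← norm_sqrtNeg_coords hm a b, ← h, ← Algebra.coe_norm_int]; simp
  simp only [map_mul, map_sub, map_intCast, h1, h2, h]
  simp only [map_add, map_mul, map_pow, map_natCast, map_ofNat]
  linear_combination (algebraMap ℚ (imagQuadField m) b) ^ 2 * sqrtNegGen_mul_self m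

/-- An element of the ring of integers of absolute value less than `1` vanishes. -/
theorem eq_zero_of_mem_intRing_of_normSq_lt {m : ℕ} (hm : m ≠ 0) {z : ℂ} (hz : z ∈ intRing m)
    (h : Complex.normSq z < 1) : z = 0 := by
  obtain ⟨x, rfl⟩ := hz
  have h1 := normSq_eq_norm hm x
  change Complex.normSq ((x : imagQuadField m) : ℂ) < 1 at h
  change ((x : imagQuadField m) : ℂ) = 0
  have h2 := Complex.normSq_nonneg ((x : imagQuadField m) : ℂ)
  rw [h1] at h h2
  rw [← Complex.normSq_eq_zero, h1]
  have h3 : Algebra.norm ℤ x < 1 := by exact_mod_cast h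
  have h4 : 0 ≤ Algebra.norm ℤ x := by exact_mod_cast h2
  have : Algebra.norm ℤ x = 0 := by omega
  rw [this]; simp

/-! ### Multiples of the discriminant -/

/-- The right side is the discriminant of the pair (1, x), which is d_K times the square of the
determinant expressing this pair in an integral basis. Explicit integers x thus bound d_K without
computing it. -/
theorem discr_dvd_trace_sq_sub {m : ℕ} (hm : m ≠ 0) (x : 𝓞 (imagQuadField m)) :
    NumberField.discr (imagQuadField m) ∣
      (Algebra.trace ℤ _ x) ^ 2 - 4 * Algebra.norm ℤ x := by
  have hcard : Fintype.card (Module.Free.ChooseBasisIndex ℤ (𝓞 (imagQuadField m))) = 2 := by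
    rw [← Module.finrank_eq_card_basis (NumberField.RingOfIntegers.basis (imagQuadField m)),
      NumberField.RingOfIntegers.rank, finrank_imagQuadField hm]
  let b := (NumberField.RingOfIntegers.basis (imagQuadField m)).reindex
    (Fintype.equivFinOfCardEq hcard)
  have h1 := Algebra.discr_of_matrix_vecMul (A := ℤ) b (b.toMatrix ![1, x])
  rw [Module.Basis.toMatrix_map_vecMul, NumberField.discr_eq_discr] at h1
  have h2 : Algebra.discr ℤ ![1, x] = (Algebra.trace ℤ _ x) ^ 2 - 4 * Algebra.norm ℤ x := by
    have h3 : Algebra.trace ℤ (𝓞 (imagQuadField m)) 1 = 2 := by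
      have := Algebra.trace_algebraMap (R := ℤ) (S := 𝓞 (imagQuadField m)) 1
      rw [map_one, NumberField.RingOfIntegers.rank, finrank_imagQuadField hm] at this
      simpa using this
    rw [Algebra.discr_def, Matrix.det_fin_two]
    simp only [Algebra.traceMatrix_apply, Algebra.traceForm_apply, Matrix.cons_val_zero,
      Matrix.cons_val_one, one_mul, mul_one, h3, trace_mul_self_eq hm]
    ring
  rw [← h2, h1]
  exact Dvd.intro_left _ rfl

theorem trace_norm_eq {m : ℕ} (hm : m ≠ 0) (x : 𝓞 (imagQuadField m)) (a b : ℚ)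
    (h : ((x : imagQuadField m) : ℂ) = a + b * sqrtNeg m) :
    (Algebra.trace ℤ _ x : ℚ) = 2 * a ∧ (Algebra.norm ℤ x : ℚ) = a ^ 2 + m * b ^ 2 := by
  have h' : (x : imagQuadField m) = algebraMap ℚ _ a + algebraMap ℚ _ b * sqrtNegGen m :=
    Subtype.ext (by simpa [sqrtNegGen] using h)
  rw [Algebra.coe_trace_int, Algebra.coe_norm_int, h', trace_sqrtNeg_coords hm,
    norm_sqrtNeg_coords hm]
  exact ⟨rfl, rfl⟩

theorem discr_dvd_four_mul {m : ℕ} (hm : m ≠ 0) :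
    NumberField.discr (imagQuadField m) ∣ 4 * m := by
  obtain ⟨x, hx⟩ := sqrtNeg_mem_intRing m
  obtain ⟨h1, h2⟩ := trace_norm_eq hm x 0 1 (by
    rw [Rat.cast_zero, Rat.cast_one, zero_add, one_mul]
    exact hx)
  have h3 : Algebra.trace ℤ _ x = 0 := by
    have : (Algebra.trace ℤ _ x : ℚ) = ((0 : ℤ) : ℚ) := by rw [h1]; simp
    exact_mod_cast this
  have h4 : Algebra.norm ℤ x = m := by
    have : (Algebra.norm ℤ x : ℚ) = ((m : ℤ) : ℚ) := by rw [h2]; simp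
    exact_mod_cast this
  have := discr_dvd_trace_sq_sub hm x
  rw [h3, h4] at this
  rw [← dvd_neg]
  rwa [show -(4 * (m : ℤ)) = 0 ^ 2 - 4 * m by ring]

/-- Here (1 + √(-m))/2 is integral, with trace 1 and norm (m + 1)/4. -/
theorem discr_dvd_of_mod_four {m : ℕ} (h4 : m % 4 = 3) :
    NumberField.discr (imagQuadField m) ∣ m := by
  have hm : m ≠ 0 := by omega
  obtain ⟨n, hn⟩ : ∃ n : ℕ, m + 1 = 4 * n := ⟨(m + 1) / 4, by omega⟩
  have hint : (1 + sqrtNeg m) / 2 ∈ intRing m := by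
    rw [mem_intRing_iff]
    refine ⟨mem_imagQuadField_iff.2 ⟨1 / 2, 1 / 2, by push_cast; ring⟩,
      Polynomial.X ^ 2 - Polynomial.X + Polynomial.C (n : ℤ), by monicity!, ?_⟩
    have : (m : ℂ) + 1 = 4 * n := by exact_mod_cast hn
    simp
    linear_combination (1 / 4 : ℂ) * sqrtNeg_sq m - (1 / 4 : ℂ) * this
  obtain ⟨x, hx⟩ := hint
  obtain ⟨h1, h2⟩ := trace_norm_eq hm x (1 / 2) (1 / 2) (by
    change ((x : imagQuadField m) : ℂ) = _ at hx
    rw [hx]; push_cast; ring)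
  have h3 : Algebra.trace ℤ _ x = 1 := by
    have : (Algebra.trace ℤ _ x : ℚ) = ((1 : ℤ) : ℚ) := by rw [h1]; norm_num
    exact_mod_cast this
  have h5 : 4 * Algebra.norm ℤ x = m + 1 := by
    have : (4 * Algebra.norm ℤ x : ℚ) = ((m + 1 : ℤ) : ℚ) := by rw [h2]; push_cast; ring
    exact_mod_cast this
  have := discr_dvd_trace_sq_sub hm x
  rw [h3, h5] at this
  rw [← dvd_neg]
  rwa [show -(m : ℤ) = 1 ^ 2 - (m + 1) by ring]

/-! ### Squarefree divisors of the discriminant and Bézout pairs -/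

section SquarefreeDivisors

variable {m d : ℕ}

theorem dvd_two_mul_of_dvd_discr (hm : m ≠ 0) (hd : Squarefree d)
    (h : (d : ℤ) ∣ NumberField.discr (imagQuadField m)) : d ∣ 2 * m := by
  have h1 : d ∣ 4 * m := by exact_mod_cast h.trans (discr_dvd_four_mul hm)
  have h2 : d ∣ (2 * m) ^ 2 := h1.trans ⟨m, by ring⟩
  exact (hd.dvd_pow_iff_dvd two_ne_zero).1 h2

theorem dvd_mul_succ_of_dvd_discr (hm : m ≠ 0) (hd : Squarefree d)
    (h : (d : ℤ) ∣ NumberField.discr (imagQuadField m)) : d ∣ m * (m + 1) := by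
  have h1 : d ∣ 2 * m := dvd_two_mul_of_dvd_discr hm hd h
  rcases Nat.even_or_odd' m with ⟨k, hk | hk⟩
  · have h2 : d ∣ m ^ 2 := h1.trans ⟨k, by rw [hk]; ring⟩
    exact ((hd.dvd_pow_iff_dvd two_ne_zero).1 h2).trans (Dvd.intro _ rfl)
  · exact h1.trans ⟨k + 1, by rw [hk]; ring⟩

/-- A common prime p satisfies p² ∣ m(m + 1). If p ∣ m, then p is prime to m + 1 and p² ∣ m, against
squarefreeness. Otherwise p = 2, since d ∣ 2m, and 4 ∣ m + 1. But then d_K divides the odd number m,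
and d cannot be even. -/
theorem coprime_div_of_dvd_discr (hm : Squarefree m) (hd : Squarefree d)
    (h : (d : ℤ) ∣ NumberField.discr (imagQuadField m)) :
    Nat.Coprime d (m * (m + 1) / d) := by
  have hm0 := hm.ne_zero
  have h1 := dvd_mul_succ_of_dvd_discr hm0 hd h
  have h2 := dvd_two_mul_of_dvd_discr hm0 hd h
  refine Nat.coprime_of_dvd fun p hp hpd hpq => ?_
  have h3 : p * p ∣ m * (m + 1) := by
    rw [← Nat.mul_div_cancel' h1]
    exact mul_dvd_mul hpd hpq
  by_cases hpm : p ∣ m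
  · have h4 : Nat.Coprime (p * p) (m + 1) := by
      have : Nat.Coprime p (m + 1) := by
        rw [hp.coprime_iff_not_dvd]
        intro h5
        exact hp.one_lt.ne' (Nat.dvd_one.1 ((Nat.dvd_add_right hpm).1 h5))
      exact this.mul_left this
    have h5 := h4.dvd_of_dvd_mul_right h3
    exact hp.one_lt.ne' (Nat.isUnit_iff.1 (hm p h5))
  · have h4 : p = 2 := by
      have := hpd.trans h2
      rcases hp.dvd_mul.1 this with h5 | h5
      · exact (Nat.prime_dvd_prime_iff_eq hp Nat.prime_two).1 h5
      · exact absurd h5 hpm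
    subst h4
    have h5 : Nat.Coprime (2 * 2) m := by
      have := (hp.coprime_iff_not_dvd).2 hpm
      exact this.mul_left this
    have h6 := h5.dvd_of_dvd_mul_left h3
    have h7 : m % 4 = 3 := by omega
    have h8 : d ∣ m := by exact_mod_cast h.trans (discr_dvd_of_mod_four h7)
    exact hpm (hpd.trans h8)

theorem conj_omega (m : ℕ) : starRingEnd ℂ (omega m) = m - sqrtNeg m := by
  simp [omega, sqrtNeg, sub_eq_add_neg]

theorem omega_mul_conj (m : ℕ) :
    omega m * starRingEnd ℂ (omega m) = ((m * (m + 1) : ℕ) : ℂ) := by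
  rw [conj_omega, omega]
  push_cast
  linear_combination -sqrtNeg_sq m

theorem omega_mem_intRing (m : ℕ) : omega m ∈ intRing m :=
  add_mem (natCast_mem _ m) (sqrtNeg_mem_intRing m)

theorem conj_omega_mem_intRing (m : ℕ) : starRingEnd ℂ (omega m) ∈ intRing m := by
  rw [conj_omega]
  exact sub_mem (natCast_mem _ m) (sqrtNeg_mem_intRing m)

theorem exists_isBezoutPair (hm : Squarefree m) (hd : Squarefree d)
    (h : (d : ℤ) ∣ NumberField.discr (imagQuadField m)) :
    ∃ u v : ℤ, IsBezoutPair m d u v := by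
  have hc := coprime_div_of_dvd_discr hm hd h
  have h1 := dvd_mul_succ_of_dvd_discr hm.ne_zero hd h
  have hd0 : (d : ℂ) ≠ 0 := by exact_mod_cast hd.ne_zero
  obtain ⟨u, v, huv⟩ := Nat.isCoprime_iff_coprime.2 hc
  refine ⟨u, -v, ?_⟩
  rw [IsBezoutPair, omega_mul_conj]
  have h2 : ((m * (m + 1) : ℕ) : ℂ) / d = ((m * (m + 1) / d : ℕ) : ℂ) := by
    rw [Nat.cast_div h1 hd0]
  rw [mul_div_assoc, h2]
  have h3 := congrArg (Int.cast (R := ℂ)) huv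
  rw [Int.cast_add, Int.cast_mul, Int.cast_mul, Int.cast_natCast, Int.cast_natCast,
    Int.cast_one] at h3
  rw [Int.cast_neg]
  linear_combination h3

/-- Meant for ω and its conjugate, the roots of X² − 2mX + m(m + 1): since d divides both 2m and m(m
+ 1), the quadratic equation can be divided by d. -/
theorem omega_sq_div_mem (hm : m ≠ 0) (hd : Squarefree d)
    (h : (d : ℤ) ∣ NumberField.discr (imagQuadField m)) {z : ℂ} (hz : z ∈ intRing m)
    (hz2 : z ^ 2 = ((2 * m : ℕ) : ℂ) * z - ((m * (m + 1) : ℕ) : ℂ)) :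
    z ^ 2 / d ∈ intRing m := by
  obtain ⟨k, hk⟩ := dvd_two_mul_of_dvd_discr hm hd h
  obtain ⟨l, hl⟩ := dvd_mul_succ_of_dvd_discr hm hd h
  have hd0 : (d : ℂ) ≠ 0 := by exact_mod_cast hd.ne_zero
  have : z ^ 2 / d = k * z - l := by
    rw [hz2, hk, hl]
    push_cast
    field_simp
  rw [this]
  exact sub_mem (mul_mem (natCast_mem _ k) hz) (natCast_mem _ l)

end SquarefreeDivisors

/-! ### The group of integral products and its discreteness -/

/-- The subgroup of all `g ∈ SL₂(ℂ)` such that the products of any two entries of `g` lie in the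
ring of integers of `ℚ(√(-m))`. -/
def integralProductGroup (m : ℕ) : Subgroup SL(2, ℂ) where
  carrier := {g | ∀ i j k l, g i j * g k l ∈ intRing m}
  one_mem' := by
    intro i j k l
    fin_cases i <;> fin_cases j <;> fin_cases k <;> fin_cases l <;>
      simp [one_mem, zero_mem]
  mul_mem' := by
    intro g h hg hh i j k l
    simp only [Matrix.SpecialLinearGroup.coe_mul, Matrix.mul_apply, Finset.sum_mul_sum]
    refine sum_mem fun x _ => sum_mem fun y _ => ?_
    have := mul_mem (hg i x k y) (hh x j y l)
    convert this using 1
    ring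
  inv_mem' := by
    intro g hg i j k l
    have h1 : ∀ i j, ∃ e : ℤ, ∃ i' j', (g⁻¹) i j = e * g i' j' := by
      intro i j
      rw [Matrix.SpecialLinearGroup.SL2_inv_expl]
      fin_cases i <;> fin_cases j
      · exact ⟨1, 1, 1, by simp⟩
      · exact ⟨-1, 0, 1, by simp⟩
      · exact ⟨-1, 1, 0, by simp⟩
      · exact ⟨1, 0, 0, by simp⟩
    obtain ⟨e, a, b, h2⟩ := h1 i j
    obtain ⟨f, c, d, h3⟩ := h1 k l
    rw [h2, h3]
    have := mul_mem (mul_mem (intCast_mem (intRing m) e) (intCast_mem (intRing m) f))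
      (hg a b c d)
    convert this using 1
    ring

theorem mem_integralProductGroup_of_sq {m : ℕ} {g : SL(2, ℂ)}
    (h : ∀ i j k l, g i j * g k l ∈ imagQuadField m) (h2 : ∀ i j, g i j ^ 2 ∈ intRing m) :
    g ∈ integralProductGroup m := by
  intro i j k l
  refine mem_intRing_of_sq (h i j k l) ?_
  rw [mul_pow]
  exact mul_mem (h2 i j) (h2 k l)

theorem bianchiGroup_le_integralProductGroup (m : ℕ) :
    bianchiGroup m ≤ integralProductGroup m := fun _ hg i j k l =>
  mul_mem (mem_bianchiGroup_iff.1 hg i j) (mem_bianchiGroup_iff.1 hg k l)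

theorem discreteTopology_integralProductGroup {m : ℕ} (hm : m ≠ 0) :
    DiscreteTopology (integralProductGroup m) := by
  apply discreteTopology_of_isOpen_singleton_one
  -- The conditions on squares force them to be 1 or 0 by integrality; those on the diagonal entries
  -- themselves exclude the sign −1.
  let U : Set SL(2, ℂ) := {g | Complex.normSq (g 0 0 ^ 2 - 1) < 1 ∧ Complex.normSq (g 0 0 - 1) < 1 ∧
    Complex.normSq (g 1 1 ^ 2 - 1) < 1 ∧ Complex.normSq (g 1 1 - 1) < 1 ∧
    Complex.normSq (g 0 1 ^ 2) < 1 ∧ Complex.normSq (g 1 0 ^ 2) < 1}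
  have hn := Complex.continuous_normSq
  have hU : IsOpen U := by
    have hc : ∀ i j, Continuous fun g : SL(2, ℂ) => g i j := fun i j => by fun_prop
    refine .inter ?_ (.inter ?_ (.inter ?_ (.inter ?_ (.inter ?_ ?_)))) <;>
      refine isOpen_lt (hn.comp ?_) continuous_const
    · exact ((hc 0 0).pow 2).sub continuous_const
    · exact (hc 0 0).sub continuous_const
    · exact ((hc 1 1).pow 2).sub continuous_const
    · exact (hc 1 1).sub continuous_const
    · exact (hc 0 1).pow 2
    · exact (hc 1 0).pow 2
  refine isOpen_induced_iff.2 ⟨U, hU, ?_⟩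
  ext ⟨g, hg⟩
  simp only [Set.mem_preimage, Set.mem_singleton_iff]
  have hsq : ∀ i j, g i j ^ 2 ∈ intRing m := fun i j => by
    rw [pow_two]; exact hg i j i j
  have hdiag : ∀ z : ℂ, z ^ 2 ∈ intRing m → Complex.normSq (z ^ 2 - 1) < 1 →
      Complex.normSq (z - 1) < 1 → z = 1 := by
    intro z hz h1 h2
    have h3 := eq_zero_of_mem_intRing_of_normSq_lt hm (sub_mem hz (one_mem _)) h1
    rcases sq_eq_one_iff.1 (sub_eq_zero.1 h3) with h | h
    · exact h
    · rw [h] at h2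
      norm_num [Complex.normSq_apply] at h2
  constructor
  · rintro ⟨h1, h2, h3, h4, h5, h6⟩
    apply Subtype.ext
    apply Matrix.SpecialLinearGroup.ext
    intro i j
    fin_cases i <;> fin_cases j
    · simpa using hdiag _ (hsq 0 0) h1 h2
    · simpa using eq_zero_of_mem_intRing_of_normSq_lt hm (hsq 0 1) h5
    · simpa using eq_zero_of_mem_intRing_of_normSq_lt hm (hsq 1 0) h6
    · simpa using hdiag _ (hsq 1 1) h3 h4
  · intro h
    have h1 : g = 1 := congrArg Subtype.val h
    subst h1
    simp [U]

/-! ### The matrices V_d -/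

theorem atkinLehner_apply {m d : ℕ} {u v : ℤ} (hd : d ≠ 0) (h : IsBezoutPair m d u v)
    (i j : Fin 2) : atkinLehner m d u v hd h i j = (1 / (Real.sqrt d : ℂ)) *
      !![(u : ℂ) * d, v * omega m; starRingEnd ℂ (omega m), (d : ℂ)] i j := rfl

theorem sqrt_natCast_sq (d : ℕ) : ((Real.sqrt d : ℝ) : ℂ) ^ 2 = d := by
  exact_mod_cast Real.sq_sqrt (Nat.cast_nonneg (α := ℝ) d)

theorem atkinLehner_mul_sqrt_mem {m d : ℕ} {u v : ℤ} (hd : d ≠ 0) (h : IsBezoutPair m d u v)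
    (i j : Fin 2) : ∃ z ∈ intRing m, atkinLehner m d u v hd h i j = z / (Real.sqrt d : ℂ) := by
  refine ⟨!![(u : ℂ) * d, v * omega m; starRingEnd ℂ (omega m), (d : ℂ)] i j, ?_, ?_⟩
  · fin_cases i <;> fin_cases j
    · exact mul_mem (intCast_mem _ u) (natCast_mem _ d)
    · exact mul_mem (intCast_mem _ v) (omega_mem_intRing m)
    · exact conj_omega_mem_intRing m
    · exact natCast_mem _ d
  · rw [atkinLehner_apply]
    ring

/-- Products of two entries lie in K because the factors 1/√d combine to 1/d. The squares of the
entries are u²d, v²ω²/d, ω̄²/d and d, all integral. -/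
theorem atkinLehner_mem_integralProductGroup {m d : ℕ} {u v : ℤ} (hm : m ≠ 0)
    (hd : Squarefree d) (hdvd : (d : ℤ) ∣ NumberField.discr (imagQuadField m))
    (h : IsBezoutPair m d u v) :
    atkinLehner m d u v hd.ne_zero h ∈ integralProductGroup m := by
  have hd0 : (d : ℂ) ≠ 0 := by exact_mod_cast hd.ne_zero
  apply mem_integralProductGroup_of_sq
  · intro i j k l
    obtain ⟨z, hz, h1⟩ := atkinLehner_mul_sqrt_mem hd.ne_zero h i j
    obtain ⟨w, hw, h2⟩ := atkinLehner_mul_sqrt_mem hd.ne_zero h k l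
    rw [h1, h2, div_mul_div_comm, ← pow_two, sqrt_natCast_sq]
    exact div_mem (mul_mem (mem_intRing_iff.1 hz).1 (mem_intRing_iff.1 hw).1) (natCast_mem _ d)
  · intro i j
    rw [atkinLehner_apply, mul_pow, div_pow, sqrt_natCast_sq]
    have h1 := omega_sq_div_mem hm hd hdvd (omega_mem_intRing m) (by
      rw [omega]; push_cast; linear_combination sqrtNeg_sq m)
    have h2 := omega_sq_div_mem hm hd hdvd (conj_omega_mem_intRing m) (by
      rw [conj_omega]; push_cast; linear_combination sqrtNeg_sq m)
    fin_cases i <;> fin_cases j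
    · convert mul_mem (pow_mem (intCast_mem (intRing m) u) 2) (natCast_mem (intRing m) d) using 1
      simp; field_simp
    · convert mul_mem (pow_mem (intCast_mem (intRing m) v) 2) h1 using 1
      simp; ring
    · convert h2 using 1
      simp; ring
    · convert natCast_mem (intRing m) d using 1
      simp; field_simp

/-! ### Coset decomposition of the group of integral products -/

/-- Norms give r² ∣ N(x)², so r ∣ N(x). Since r also divides Tr(x²) = Tr(x)² − 2N(x), it divides
Tr(x)², and squarefreeness finishes. -/
theorem dvd_trace_of_dvd_mul_self {m r : ℕ} (hm : m ≠ 0) (hr : Squarefree r)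
    {x : 𝓞 (imagQuadField m)} (h : (r : 𝓞 (imagQuadField m)) ∣ x * x) :
    (r : ℤ) ∣ Algebra.trace ℤ _ x := by
  obtain ⟨y, hy⟩ := h
  have hfin : Module.finrank ℤ (𝓞 (imagQuadField m)) = 2 := by
    rw [NumberField.RingOfIntegers.rank, finrank_imagQuadField hm]
  have hr' : Squarefree (r : ℤ) := Int.squarefree_natCast.2 hr
  have hcast : (r : 𝓞 (imagQuadField m)) = algebraMap ℤ _ (r : ℤ) := by simp
  have h1 : (r : ℤ) ∣ Algebra.norm ℤ x := by
    have h2 := congrArg (Algebra.norm ℤ) hy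
    rw [map_mul, map_mul, hcast, Algebra.norm_algebraMap, hfin] at h2
    have h3 : (r : ℤ) ^ 2 ∣ Algebra.norm ℤ x ^ 2 := ⟨_, by rw [pow_two (Algebra.norm ℤ x), h2]⟩
    exact (Int.pow_dvd_pow_iff two_ne_zero).1 h3
  have h4 : (r : ℤ) ∣ Algebra.trace ℤ _ (x * x) := by
    rw [hy, hcast, ← Algebra.smul_def, map_smul]
    exact Dvd.intro _ rfl
  rw [trace_mul_self_eq hm] at h4
  have h5 : (r : ℤ) ∣ (Algebra.trace ℤ _ x) ^ 2 := by
    have := dvd_add h4 (h1.mul_left 2)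
    rwa [sub_add_cancel] at this
  exact (hr'.dvd_pow_iff_dvd two_ne_zero).1 h5

/-- The square of x·b i is again divisible by r, so r divides every trace Tr(x·b i). Thus the trace
matrix sends the coordinates of x into r times integers; its adjugate turns this into a statement
about its determinant d_K times x. -/
theorem dvd_discr_mul_of_dvd_mul_self {m r : ℕ} (hm : m ≠ 0) (hr : Squarefree r)
    {x : 𝓞 (imagQuadField m)} (h : (r : 𝓞 (imagQuadField m)) ∣ x * x) :
    (r : 𝓞 (imagQuadField m)) ∣ (NumberField.discr (imagQuadField m) : 𝓞 _) * x := by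
  let b := NumberField.RingOfIntegers.basis (imagQuadField m)
  have h1 : ∀ i, (r : ℤ) ∣ Algebra.trace ℤ _ (x * b i) := fun i =>
    dvd_trace_of_dvd_mul_self hm hr (by
      rw [mul_mul_mul_comm]; exact h.mul_right _)
  choose w hw using h1
  have h2 := Algebra.traceMatrix_of_basis_mulVec (A := ℤ) b x
  have h3 : (Algebra.traceMatrix ℤ b).mulVec (b.equivFun x) = (r : ℤ) • w := by
    rw [h2]; ext i; simpa using hw i
  have h4 : NumberField.discr (imagQuadField m) • b.equivFun x =
      (r : ℤ) • (Algebra.traceMatrix ℤ b).adjugate.mulVec w := by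
    rw [← Matrix.mulVec_smul, ← h3, Matrix.mulVec_mulVec, Matrix.adjugate_mul,
      Matrix.smul_mulVec, Matrix.one_mulVec]
    rfl
  refine ⟨b.equivFun.symm ((Algebra.traceMatrix ℤ b).adjugate.mulVec w), ?_⟩
  apply b.equivFun.injective
  rw [← Int.cast_natCast (R := 𝓞 (imagQuadField m)), ← zsmul_eq_mul, ← zsmul_eq_mul,
    map_zsmul, map_zsmul, h4, LinearEquiv.apply_symm_apply]

/-- Multiplying all four entries by D = d_K makes them divisible by r, so r² divides D²·r and r
divides D² in 𝓞_K. Taking norms, r² ∣ D⁴, and r is squarefree. -/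
theorem dvd_discr_of_det_eq {m r : ℕ} (hm : m ≠ 0) (hr : Squarefree r)
    {x y z w : 𝓞 (imagQuadField m)} (hx : (r : 𝓞 (imagQuadField m)) ∣ x * x)
    (hy : (r : 𝓞 (imagQuadField m)) ∣ y * y) (hz : (r : 𝓞 (imagQuadField m)) ∣ z * z)
    (hw : (r : 𝓞 (imagQuadField m)) ∣ w * w) (hdet : x * w - y * z = r) :
    (r : ℤ) ∣ NumberField.discr (imagQuadField m) := by
  have hr0 : (r : 𝓞 (imagQuadField m)) ≠ 0 := by exact_mod_cast hr.ne_zero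
  have hfin : Module.finrank ℤ (𝓞 (imagQuadField m)) = 2 := by
    rw [NumberField.RingOfIntegers.rank, finrank_imagQuadField hm]
  obtain ⟨x', hx'⟩ := dvd_discr_mul_of_dvd_mul_self hm hr hx
  obtain ⟨y', hy'⟩ := dvd_discr_mul_of_dvd_mul_self hm hr hy
  obtain ⟨z', hz'⟩ := dvd_discr_mul_of_dvd_mul_self hm hr hz
  obtain ⟨w', hw'⟩ := dvd_discr_mul_of_dvd_mul_self hm hr hw
  set D := NumberField.discr (imagQuadField m)
  have h1 : (D : 𝓞 (imagQuadField m)) ^ 2 = r * (x' * w' - y' * z') := by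
    apply mul_left_cancel₀ hr0
    linear_combination (-(D : 𝓞 (imagQuadField m)) ^ 2) * hdet + D * w * hx' + r * x' * hw' -
      D * z * hy' - r * y' * hz'
  have h2 := congrArg (Algebra.norm ℤ) h1
  have hN : ∀ c : ℤ, Algebra.norm ℤ (c : 𝓞 (imagQuadField m)) = c ^ 2 := fun c => by
    rw [← eq_intCast (algebraMap ℤ (𝓞 (imagQuadField m))) c, Algebra.norm_algebraMap, hfin]
  rw [map_mul, map_pow, ← Int.cast_natCast (R := 𝓞 (imagQuadField m)), hN, hN] at h2
  have h3 : (r : ℤ) ^ 2 ∣ (D ^ 2) ^ 2 := ⟨_, h2⟩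
  exact ((Int.squarefree_natCast.2 hr).dvd_pow_iff_dvd two_ne_zero).1
    ((Int.pow_dvd_pow_iff two_ne_zero).1 h3)

/-- With T the trace of a, a² − Ta + n² = 0 gives (a + n)² = (T + 2n)a, so q = T + 2n works unless
it vanishes. In that case a = −n and q = −n works. -/
theorem exists_mul_sq_eq_sq_of_norm_eq_sq {m : ℕ} (hm : m ≠ 0) {a : 𝓞 (imagQuadField m)}
    (ha : a ≠ 0) {n : ℕ} (h : Algebra.norm ℤ a = (n : ℤ) ^ 2) :
    ∃ q : ℕ, q ≠ 0 ∧ ∃ k ∈ imagQuadField m, (q : ℂ) * ((a : imagQuadField m) : ℂ) = k ^ 2 := by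
  have hn : n ≠ 0 := by
    rintro rfl
    apply ha
    simpa using h
  have h1 : ∃ q : ℤ, q ≠ 0 ∧ ∃ k : 𝓞 (imagQuadField m), q * a = k ^ 2 := by
    have h2 := mul_self_eq_trace_mul_sub_norm hm a
    rw [h] at h2
    push_cast at h2
    by_cases hT : Algebra.trace ℤ _ a + 2 * (n : ℤ) = 0
    · refine ⟨-n, by simpa using hn, a, ?_⟩
      have h3 : ((Algebra.trace ℤ _ a : ℤ) : 𝓞 (imagQuadField m)) = -(2 * n) := by
        rw [eq_neg_of_add_eq_zero_left hT]; push_cast; rfl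
      rw [h3] at h2
      have h4 : (a + n) ^ 2 = 0 := by linear_combination h2
      have h5 : a = -(n : 𝓞 (imagQuadField m)) :=
        eq_neg_of_add_eq_zero_left (pow_eq_zero_iff two_ne_zero |>.1 h4)
      rw [h5]; push_cast; ring
    · refine ⟨_, hT, a + n, ?_⟩
      push_cast
      linear_combination -h2
  obtain ⟨q, hq, k, hk⟩ := h1
  have hk' : (q : ℂ) * ((a : imagQuadField m) : ℂ) = ((k : imagQuadField m) : ℂ) ^ 2 := by
    have := congrArg (algebraMap (𝓞 (imagQuadField m)) ℂ) hk
    rw [map_mul, map_pow, map_intCast] at this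
    exact this
  -- A negative q is made positive by multiplying by −m, which is a square in K.
  rcases lt_or_gt_of_ne hq with h0 | h0
  · refine ⟨q.natAbs * m, mul_ne_zero (Int.natAbs_ne_zero.2 hq) hm,
      sqrtNeg m * (k : imagQuadField m), mul_mem (sqrtNeg_mem m) (k : imagQuadField m).2, ?_⟩
    have h2 : (q.natAbs : ℂ) = -(q : ℂ) := by
      rw [← Int.cast_natCast, Int.ofNat_natAbs_of_nonpos h0.le]; push_cast; rfl
    push_cast
    rw [h2, mul_pow, sqrtNeg_sq]
    linear_combination -(m : ℂ) * hk'
  · refine ⟨q.natAbs, Int.natAbs_ne_zero.2 hq, k, (k : imagQuadField m).2, ?_⟩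
    have h2 : (q.natAbs : ℂ) = (q : ℂ) := by
      rw [← Int.cast_natCast, Int.natAbs_of_nonneg h0.le]
    rw [h2, hk']

theorem det_eq_one (g : SL(2, ℂ)) : g 0 0 * g 1 1 - g 0 1 * g 1 0 = 1 := by
  rw [← Matrix.det_fin_two]; exact g.2

/-- The ideal I generated by the products of g i j with the entries of g satisfies I² = (g i j ²):
one inclusion is integrality of products of entries, the other is det g = 1 multiplied by g i j ².
So the norm is the square of `Ideal.absNorm I`; no sign arises, as K is imaginary. -/
theorem exists_norm_sq_entry_eq_sq {m : ℕ} (hm : m ≠ 0) {g : SL(2, ℂ)}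
    (hg : g ∈ integralProductGroup m) (i j : Fin 2) :
    ∃ a : 𝓞 (imagQuadField m), ((a : imagQuadField m) : ℂ) = g i j ^ 2 ∧
      ∃ n : ℕ, Algebra.norm ℤ a = (n : ℤ) ^ 2 := by
  have hinj : Function.Injective (algebraMap (𝓞 (imagQuadField m)) ℂ) :=
    fun x y hxy => NumberField.RingOfIntegers.ext (Subtype.ext hxy)
  choose e he using fun k l => hg i j k l
  choose f hf using fun k l k' l' => hg k l k' l'
  have hprod : ∀ k l k' l', e k l * e k' l' = e i j * f k l k' l' := by
    intro k l k' l'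
    apply hinj
    rw [map_mul, map_mul, he, he, he, hf]
    ring
  have hone : e i j = e 0 0 * e 1 1 - e 0 1 * e 1 0 := by
    apply hinj
    rw [map_sub, map_mul, map_mul, he, he, he, he, he]
    linear_combination -(g i j) ^ 2 * det_eq_one g
  let I : Ideal (𝓞 (imagQuadField m)) := Ideal.span (Set.range fun p : Fin 2 × Fin 2 => e p.1 p.2)
  have hI : I * I = Ideal.span {e i j} := by
    apply le_antisymm
    · rw [Ideal.span_mul_span', Ideal.span_le]
      rintro _ ⟨_, ⟨p, rfl⟩, _, ⟨q, rfl⟩, rfl⟩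
      exact Ideal.mem_span_singleton.2 ⟨_, hprod _ _ _ _⟩
    · rw [Ideal.span_singleton_le_iff_mem, hone]
      have hmem : ∀ k l, e k l ∈ I := fun k l => Ideal.subset_span ⟨(k, l), rfl⟩
      exact sub_mem (Ideal.mul_mem_mul (hmem _ _) (hmem _ _))
        (Ideal.mul_mem_mul (hmem _ _) (hmem _ _))
  refine ⟨e i j, (he i j).trans (pow_two _).symm, Ideal.absNorm I, ?_⟩
  have h1 := congrArg Ideal.absNorm hI
  rw [map_mul, Ideal.absNorm_span_singleton] at h1
  have h2 : 0 ≤ Algebra.norm ℤ (e i j) := by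
    have := Complex.normSq_nonneg ((e i j : imagQuadField m) : ℂ)
    rw [normSq_eq_norm hm] at this
    exact_mod_cast this
  rw [← Int.natAbs_of_nonneg h2, ← h1]
  push_cast
  ring

theorem exists_squarefree_sqrt_mul_mem {m : ℕ} (hm : m ≠ 0) {g : SL(2, ℂ)}
    (hg : g ∈ integralProductGroup m) :
    ∃ r : ℕ, Squarefree r ∧ ∀ i j, (Real.sqrt r : ℂ) * g i j ∈ imagQuadField m := by
  obtain ⟨i, j, hij⟩ : ∃ i j, g i j ≠ 0 := by
    by_contra! h
    have := det_eq_one g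
    simp [h] at this
  obtain ⟨a, ha, n, hn⟩ := exists_norm_sq_entry_eq_sq hm hg i j
  have ha0 : a ≠ 0 := by
    rintro rfl
    apply hij
    simpa using ha.symm
  obtain ⟨q, hq, k, hk, hqk⟩ := exists_mul_sq_eq_sq_of_norm_eq_sq hm ha0 hn
  -- With q = b²r and q·(g i j)² = k², the number √r·g i j is ±k/b; the other entries follow since
  -- products of entries lie in K.
  obtain ⟨r, b, hrb, hr⟩ := Nat.sq_mul_squarefree q
  have hb : (b : ℂ) ≠ 0 := by
    rintro h
    have : b = 0 := by exact_mod_cast h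
    apply hq
    rw [← hrb, this]; simp
  refine ⟨r, hr, ?_⟩
  have h1 : ((Real.sqrt r : ℂ) * g i j) ^ 2 = (k / b) ^ 2 := by
    rw [mul_pow, sqrt_natCast_sq, div_pow, ← hqk, ha, ← hrb]
    push_cast
    field_simp
  have h2 : (Real.sqrt r : ℂ) * g i j ∈ imagQuadField m := by
    have h3 : k / b ∈ imagQuadField m := div_mem hk (natCast_mem _ b)
    rcases sq_eq_sq_iff_eq_or_eq_neg.1 h1 with h | h
    · rwa [h]
    · rw [h]; exact neg_mem h3
  intro i' j'
  have h4 : (Real.sqrt r : ℂ) * g i' j' =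
      (Real.sqrt r : ℂ) * g i j * (g i j * g i' j') / (g i j * g i j) := by
    field_simp
  rw [h4]
  exact div_mem (mul_mem h2 (mem_intRing_iff.1 (hg _ _ _ _)).1) (mem_intRing_iff.1 (hg _ _ _ _)).1

theorem mem_bianchiGroup_of_mem_integralProductGroup {m : ℕ} {g : SL(2, ℂ)}
    (hg : g ∈ integralProductGroup m) (h : ∀ i j, g i j ∈ imagQuadField m) :
    g ∈ bianchiGroup m :=
  mem_bianchiGroup_iff.2 fun i j => mem_intRing_of_sq (h i j) (by rw [pow_two]; exact hg i j i j)

theorem dvd_discr_of_sqrt_mul_mem {m r : ℕ} (hm : m ≠ 0) (hr : Squarefree r) {g : SL(2, ℂ)}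
    (hg : g ∈ integralProductGroup m)
    (h : ∀ i j, (Real.sqrt r : ℂ) * g i j ∈ imagQuadField m) :
    (r : ℤ) ∣ NumberField.discr (imagQuadField m) := by
  have hinj : Function.Injective (algebraMap (𝓞 (imagQuadField m)) ℂ) :=
    fun x y hxy => NumberField.RingOfIntegers.ext (Subtype.ext hxy)
  have h1 : ∀ i j, (Real.sqrt r : ℂ) * g i j ∈ intRing m := fun i j => by
    refine mem_intRing_of_sq (h i j) ?_
    rw [mul_pow, sqrt_natCast_sq, pow_two]
    exact mul_mem (natCast_mem _ r) (hg i j i j)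
  choose e he using h1
  choose f hf using fun i j => hg i j i j
  have hdvd : ∀ i j, (r : 𝓞 (imagQuadField m)) ∣ e i j * e i j := fun i j => by
    refine ⟨f i j, hinj ?_⟩
    rw [map_mul, map_mul, he, hf, map_natCast]
    linear_combination (g i j) ^ 2 * sqrt_natCast_sq r
  refine dvd_discr_of_det_eq hm hr (hdvd 0 0) (hdvd 0 1) (hdvd 1 0) (hdvd 1 1) (hinj ?_)
  rw [map_sub, map_mul, map_mul, he, he, he, he, map_natCast]
  linear_combination (r : ℂ) * det_eq_one g +
    (g 0 0 * g 1 1 - g 0 1 * g 1 0) * sqrt_natCast_sq r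

/-- Both g and V_r have entries in K/√r, so the quotient has entries in K; it also has integral
products, hence integral entries. -/
theorem mul_inv_atkinLehner_mem {m r : ℕ} {u v : ℤ} (hm : m ≠ 0) (hr : Squarefree r)
    {g : SL(2, ℂ)} (hg : g ∈ integralProductGroup m)
    (h : ∀ i j, (Real.sqrt r : ℂ) * g i j ∈ imagQuadField m) (huv : IsBezoutPair m r u v) :
    g * (atkinLehner m r u v hr.ne_zero huv)⁻¹ ∈ bianchiGroup m := by
  have hV := atkinLehner_mem_integralProductGroup hm hr (dvd_discr_of_sqrt_mul_mem hm hr hg h) huv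
  refine mem_bianchiGroup_of_mem_integralProductGroup (mul_mem hg (inv_mem hV)) ?_
  have h1 : ∀ i j k l, g i j * atkinLehner m r u v hr.ne_zero huv k l ∈ imagQuadField m := by
    intro i j k l
    obtain ⟨z, hz, h2⟩ := atkinLehner_mul_sqrt_mem hr.ne_zero huv k l
    have hs := sqrt_natCast_sq r
    have hr0 : (r : ℂ) ≠ 0 := by exact_mod_cast hr.ne_zero
    have hs0 : (Real.sqrt r : ℂ) ≠ 0 := fun h => hr0 (by rw [← hs, h]; simp)
    have h3 : g i j * (z / (Real.sqrt r : ℂ)) = (Real.sqrt r : ℂ) * g i j * z / r := by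
      rw [← hs]; field_simp
    rw [h2, h3]
    exact div_mem (mul_mem (h i j) (mem_intRing_iff.1 hz).1) (natCast_mem _ r)
  intro i j
  rw [Matrix.SpecialLinearGroup.coe_mul, Matrix.mul_apply, Fin.sum_univ_two,
    Matrix.SpecialLinearGroup.SL2_inv_expl]
  fin_cases j
  · simpa [sub_eq_add_neg] using sub_mem (h1 i 0 1 1) (h1 i 1 1 0)
  · have := sub_mem (h1 i 1 0 0) (h1 i 0 0 1)
    simpa [sub_eq_neg_add] using this

theorem integralProductGroup_eq_iUnion {m : ℕ} (hm : m ≠ 0)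
    (u v : SqfreeDiscrDivisor m → ℤ)
    (h : ∀ d : SqfreeDiscrDivisor m, IsBezoutPair m d (u d) (v d)) :
    (integralProductGroup m : Set SL(2, ℂ)) =
      ⋃ d : SqfreeDiscrDivisor m,
        (fun γ => γ * atkinLehner m d (u d) (v d) d.2.1.ne_zero (h d)) ''
          (bianchiGroup m : Set SL(2, ℂ)) := by
  ext g
  simp only [Set.mem_iUnion, Set.mem_image, SetLike.mem_coe]
  constructor
  · intro hg
    obtain ⟨r, hr, hgr⟩ := exists_squarefree_sqrt_mul_mem hm hg
    let d : SqfreeDiscrDivisor m := ⟨r, hr, dvd_discr_of_sqrt_mul_mem hm hr hg hgr⟩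
    exact ⟨d, _, mul_inv_atkinLehner_mem hm hr hg hgr (h d), inv_mul_cancel_right _ _⟩
  · rintro ⟨d, γ, hγ, rfl⟩
    exact mul_mem (bianchiGroup_le_integralProductGroup m hγ)
      (atkinLehner_mem_integralProductGroup hm d.2.1 d.2.2 (h d))

/-! ### Unipotent matrices over a commutative ring -/

/-- The matrix `!![0, -1; 1, 0]` in `SL₂(R)`. -/
def weylElt (R : Type*) [CommRing R] : SL(2, R) := ⟨!![0, -1; 1, 0], by simp⟩

/-- The unipotent matrix fixing the vector `(a, c)`, namely the identity plus `t` times the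
nilpotent matrix `!![-a * c, a ^ 2; -c ^ 2, a * c]`. -/
def unipotent {R : Type*} [CommRing R] (a c t : R) : SL(2, R) :=
  ⟨!![1 - t * (a * c), t * a ^ 2; -(t * c ^ 2), 1 + t * (a * c)], by
    rw [Matrix.det_fin_two_of]; ring⟩

section Unipotent

variable {R : Type*} [CommRing R]

theorem coe_weylElt : (weylElt R : Matrix (Fin 2) (Fin 2) R) = !![0, -1; 1, 0] := rfl

theorem coe_unipotent (a c t : R) : (unipotent a c t : Matrix (Fin 2) (Fin 2) R) =
    !![1 - t * (a * c), t * a ^ 2; -(t * c ^ 2), 1 + t * (a * c)] := rfl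

/-- Conjugation by g moves the fixed vector by g and keeps the parameter t. Every parabolic element
used below is obtained this way. -/
theorem mul_unipotent_mul_inv (g : SL(2, R)) (a c t : R) :
    g * unipotent a c t * g⁻¹ =
      unipotent (g 0 0 * a + g 0 1 * c) (g 1 0 * a + g 1 1 * c) t := by
  rw [mul_inv_eq_iff_eq_mul]
  have h : g 0 0 * g 1 1 - g 0 1 * g 1 0 = 1 := by rw [← Matrix.det_fin_two]; exact g.2
  ext i j
  fin_cases i <;> fin_cases j <;>
    simp [coe_unipotent, Matrix.mul_apply, Fin.sum_univ_two]
  · linear_combination (g 0 0 * a + g 0 1 * c) * t * c * h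
  · linear_combination (g 0 0 * a + g 0 1 * c) * t * (-a) * h
  · linear_combination (g 1 0 * a + g 1 1 * c) * t * c * h
  · linear_combination (g 1 0 * a + g 1 1 * c) * t * (-a) * h

theorem unipotent_add (s t : R) : unipotent 1 0 (s + t) = unipotent 1 0 s * unipotent 1 0 t := by
  ext i j
  fin_cases i <;> fin_cases j <;>
    simp [coe_unipotent, Matrix.mul_apply, Fin.sum_univ_two, add_comm]

theorem unipotent_zero : unipotent 1 0 (0 : R) = 1 := by
  ext i j
  fin_cases i <;> fin_cases j <;> simp [coe_unipotent]

theorem weylElt_mem_range {K : Type*} [CommRing K] [Algebra R K] :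
    weylElt K ∈ (Matrix.SpecialLinearGroup.map (n := Fin 2) (algebraMap R K)).range :=
  ⟨weylElt R, by
    ext i j
    fin_cases i <;> fin_cases j <;> simp [coe_weylElt, Matrix.SpecialLinearGroup.map_apply_coe]⟩

end Unipotent

/-! ### Overgroups of SL₂(R) over a Dedekind domain -/

section Dedekind

open IsDedekindDomain Matrix.SpecialLinearGroup

variable {R K : Type*} [CommRing R] [IsDedekindDomain R] [Field K] [Algebra R K]
  [IsFractionRing R K] (H : Subgroup SL(2, K))

/-- Multiplication by `weylElt` on either side permutes rows or columns up to sign, so an entry of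
largest valuation can be moved to the corner. -/
theorem exists_max_entry_corner (hR : (map (n := Fin 2) (algebraMap R K)).range ≤ H)
    (v : HeightOneSpectrum R) {g : SL(2, K)} (hg : g ∈ H) :
    ∃ h ∈ H, (∀ i j, v.valuation K (g i j) ≤ v.valuation K (h 0 0)) ∧
      ∀ i j, v.valuation K (h i j) ≤ v.valuation K (h 0 0) := by
  obtain ⟨⟨i, j⟩, hij⟩ := Finite.exists_max fun p : Fin 2 × Fin 2 => v.valuation K (g p.1 p.2)
  have hW := hR weylElt_mem_range
  have hmax : ∀ k l, v.valuation K (g k l) ≤ v.valuation K (g i j) := fun k l => hij (k, l)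
  obtain ⟨h, hh, e, he⟩ : ∃ h ∈ H, ∃ e : Fin 2 × Fin 2 ≃ Fin 2 × Fin 2,
      e (0, 0) = (i, j) ∧
      ∀ p : Fin 2 × Fin 2, v.valuation K (h p.1 p.2) = v.valuation K (g (e p).1 (e p).2) := by
    have hl : ∀ g : SL(2, K), ∀ l, v.valuation K ((weylElt K * g) 0 l) = v.valuation K (g 1 l) ∧
        v.valuation K ((weylElt K * g) 1 l) = v.valuation K (g 0 l) := by
      intro g l
      simp [coe_weylElt, Matrix.mul_apply, Fin.sum_univ_two, Valuation.map_neg]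
    have hr : ∀ g : SL(2, K), ∀ k, v.valuation K ((g * weylElt K) k 0) = v.valuation K (g k 1) ∧
        v.valuation K ((g * weylElt K) k 1) = v.valuation K (g k 0) := by
      intro g k
      simp [coe_weylElt, Matrix.mul_apply, Fin.sum_univ_two, Valuation.map_neg]
    fin_cases i <;> fin_cases j
    · exact ⟨g, hg, Equiv.refl _, rfl, fun p => rfl⟩
    · refine ⟨g * weylElt K, mul_mem hg hW, Equiv.prodCongr (Equiv.refl _) (Equiv.swap 0 1),
        by simp, ?_⟩
      rintro ⟨k, l⟩
      fin_cases l
      · simpa using (hr g k).1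
      · simpa using (hr g k).2
    · refine ⟨weylElt K * g, mul_mem hW hg, Equiv.prodCongr (Equiv.swap 0 1) (Equiv.refl _),
        by simp, ?_⟩
      rintro ⟨k, l⟩
      fin_cases k
      · simpa using (hl g l).1
      · simpa using (hl g l).2
    · refine ⟨weylElt K * (g * weylElt K), mul_mem hW (mul_mem hg hW),
        Equiv.prodCongr (Equiv.swap 0 1) (Equiv.swap 0 1), by simp, ?_⟩
      rintro ⟨k, l⟩
      fin_cases k <;> fin_cases l
      · simpa using (hl _ 0).1.trans (hr g 1).1
      · simpa using (hl _ 1).1.trans (hr g 1).2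
      · simpa using (hl _ 0).2.trans (hr g 0).1
      · simpa using (hl _ 1).2.trans (hr g 0).2
  have h00 : v.valuation K (h 0 0) = v.valuation K (g i j) := by
    have := he.2 (0, 0)
    rwa [he.1] at this
  refine ⟨h, hh, fun k l => by rw [h00]; exact hmax k l, fun k l => ?_⟩
  rw [h00, he.2 (k, l)]
  exact hmax _ _

theorem exists_small_bottom_row (hR : (map (n := Fin 2) (algebraMap R K)).range ≤ H)
    (v : HeightOneSpectrum R) {g : SL(2, K)} (hg : g ∈ H) {i j : Fin 2}
    (h1 : 1 < v.valuation K (g i j)) :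
    ∃ h ∈ H, v.valuation K (g i j) ≤ v.valuation K (h 0 0) ∧
      v.valuation K (h 0 1) ≤ v.valuation K (h 0 0) ∧
      v.valuation K (h 1 0) ≤ (v.valuation K (h 0 0))⁻¹ ∧
      v.valuation K (h 1 1) ≤ (v.valuation K (h 0 0))⁻¹ := by
  obtain ⟨h, hh, hle, hmax⟩ := exists_max_entry_corner H hR v hg
  have hk : 1 < v.valuation K (h 0 0) := h1.trans_le (hle i j)
  have hk0 : v.valuation K (h 0 0) ≠ 0 := (zero_lt_one.trans hk).ne'
  have ha0 : h 0 0 ≠ 0 := (Valuation.ne_zero_iff _).1 hk0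
  have hdiv : v.valuation K (-(h 1 0 / h 0 0)) ≤ 1 := by
    rw [Valuation.map_neg, map_div₀]
    exact div_le_one_of_le₀ (hmax 1 0) zero_le
  -- Writing κ for the valuation of the corner, an approximation to precision κ⁻² makes the row
  -- operation by l shrink the lower left entry to κ⁻¹; the determinant then bounds the lower right
  -- entry.
  obtain ⟨l, hl⟩ := v.exists_valuation_sub_lt_of_integer hdiv
    (Units.mk0 ((v.valuation K (h 0 0)) ^ 2)⁻¹ (inv_ne_zero (pow_ne_zero 2 hk0)))
  rw [Units.val_mk0] at hl
  let L : SL(2, R) := unipotent 0 1 (-l)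
  have hL : map (n := Fin 2) (algebraMap R K) L ∈ H := hR ⟨L, rfl⟩
  have hdet : h 0 0 * h 1 1 - h 0 1 * h 1 0 = 1 := by rw [← Matrix.det_fin_two]; exact h.2
  set h' := map (n := Fin 2) (algebraMap R K) L * h with hh'
  have e00 : h' 0 0 = h 0 0 := by
    simp [hh', L, coe_unipotent, map_apply_coe, Matrix.mul_apply, Fin.sum_univ_two]
  have e01 : h' 0 1 = h 0 1 := by
    simp [hh', L, coe_unipotent, map_apply_coe, Matrix.mul_apply, Fin.sum_univ_two]
  have e10 : h' 1 0 = algebraMap R K l * h 0 0 + h 1 0 := by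
    simp [hh', L, coe_unipotent, map_apply_coe, Matrix.mul_apply, Fin.sum_univ_two]
  have hdet' : h' 0 0 * h' 1 1 - h' 0 1 * h' 1 0 = 1 := by rw [← Matrix.det_fin_two]; exact h'.2
  have b10 : v.valuation K (h' 1 0) ≤ (v.valuation K (h 0 0))⁻¹ := by
    have : h' 1 0 = (algebraMap R K l - -(h 1 0 / h 0 0)) * h 0 0 := by
      rw [e10]; field_simp; ring
    rw [this, map_mul]
    calc _ ≤ ((v.valuation K (h 0 0)) ^ 2)⁻¹ * v.valuation K (h 0 0) :=
          mul_le_mul_left hl.le _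
      _ = _ := by rw [pow_two, mul_inv, mul_assoc, inv_mul_cancel₀ hk0, mul_one]
  have b11 : v.valuation K (h' 1 1) ≤ (v.valuation K (h 0 0))⁻¹ := by
    have : h' 1 1 = (1 + h' 0 1 * h' 1 0) * (h 0 0)⁻¹ := by
      rw [← e00]
      rw [← e00] at ha0
      field_simp
      linear_combination hdet'
    rw [this, map_mul, map_inv₀]
    refine mul_le_of_le_one_left' ?_
    refine (Valuation.map_add _ _ _).trans (max_le (map_one _).le ?_)
    rw [map_mul, e01]
    calc _ ≤ v.valuation K (h 0 0) * (v.valuation K (h 0 0))⁻¹ := mul_le_mul' (hmax 0 1) b10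
      _ = 1 := mul_inv_cancel₀ hk0
  exact ⟨h', mul_mem hL hh, by rw [e00]; exact hle i j, by rw [e00, e01]; exact hmax 0 1,
    by rw [e00]; exact b10, by rw [e00]; exact b11⟩

/-- Squaring a matrix with a small bottom row squares the valuation κ > 1 of its corner: the
correction h₀₁h₁₀ has valuation at most 1 < κ². -/
theorem exists_entry_pow_le (hR : (map (n := Fin 2) (algebraMap R K)).range ≤ H)
    (v : HeightOneSpectrum R) {g : SL(2, K)} (hg : g ∈ H) {i j : Fin 2}
    (h1 : 1 < v.valuation K (g i j)) (n : ℕ) :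
    ∃ h ∈ H, ∃ k l, (v.valuation K (g i j)) ^ (n + 1) ≤ v.valuation K (h k l) := by
  induction n with
  | zero => exact ⟨g, hg, i, j, by simp⟩
  | succ n ih =>
    obtain ⟨h, hh, k, l, hkl⟩ := ih
    have hgt : 1 < v.valuation K (h k l) := (one_lt_pow₀ h1 n.succ_ne_zero).trans_le hkl
    obtain ⟨h', hh', hle, h01, h10, -⟩ := exists_small_bottom_row H hR v hh hgt
    have hk : 1 < v.valuation K (h' 0 0) := hgt.trans_le hle
    have hk0 : v.valuation K (h' 0 0) ≠ 0 := (zero_lt_one.trans hk).ne'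
    refine ⟨h' * h', mul_mem hh' hh', 0, 0, ?_⟩
    have e : (h' * h') 0 0 = h' 0 0 ^ 2 + h' 0 1 * h' 1 0 := by
      rw [Matrix.SpecialLinearGroup.coe_mul, Matrix.mul_apply, Fin.sum_univ_two, pow_two]
    have hlt : v.valuation K (h' 0 1 * h' 1 0) < v.valuation K (h' 0 0 ^ 2) := by
      rw [map_mul, map_pow]
      calc _ ≤ v.valuation K (h' 0 0) * (v.valuation K (h' 0 0))⁻¹ := mul_le_mul' h01 h10
        _ = 1 := mul_inv_cancel₀ hk0
        _ < _ := one_lt_pow₀ hk two_ne_zero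
    rw [e, Valuation.map_add_eq_of_lt_left _ hlt, map_pow]
    calc _ ≤ ((v.valuation K (g i j)) ^ (n + 1)) ^ 2 := by
          rw [← pow_mul]; exact pow_le_pow_right₀ h1.le (by omega)
      _ ≤ _ := pow_le_pow_left₀ zero_le (hkl.trans hle) 2

/-- The test element s is h₀₀² times an element prime to v that clears the remaining denominators.
Then s times the products of bottom entries is integral, so N·s is integral, and this is read off at
v. -/
theorem valuation_mul_sq_le_one {N : R}
    (hN : ∀ g ∈ H, ∀ s : K, s * g 1 0 ^ 2 ∈ (algebraMap R K).range →
      s * (g 1 0 * g 1 1) ∈ (algebraMap R K).range → s * g 1 1 ^ 2 ∈ (algebraMap R K).range →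
      algebraMap R K N * s ∈ (algebraMap R K).range)
    (v : HeightOneSpectrum R) {h : SL(2, K)} (hh : h ∈ H)
    (hk0 : v.valuation K (h 0 0) ≠ 0)
    (h10 : v.valuation K (h 1 0) ≤ (v.valuation K (h 0 0))⁻¹)
    (h11 : v.valuation K (h 1 1) ≤ (v.valuation K (h 0 0))⁻¹) :
    v.valuation K (algebraMap R K N) * v.valuation K (h 0 0) ^ 2 ≤ 1 := by
  have key : ∀ x y : K, v.valuation K x ≤ (v.valuation K (h 0 0))⁻¹ →
      v.valuation K y ≤ (v.valuation K (h 0 0))⁻¹ →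
      ∃ t : v.asIdeal.primeCompl, ∃ n : R,
        h 0 0 ^ 2 * (x * y) * algebraMap R K t = algebraMap R K n := by
    intro x y hx hy
    have : v.valuation K (h 0 0 ^ 2 * (x * y)) ≤ 1 := by
      rw [map_mul, map_mul, map_pow]
      calc _ ≤ v.valuation K (h 0 0) ^ 2 *
            ((v.valuation K (h 0 0))⁻¹ * (v.valuation K (h 0 0))⁻¹) :=
            mul_le_mul_right (mul_le_mul' hx hy) _
        _ = 1 := by rw [← mul_inv, ← pow_two, mul_inv_cancel₀ (pow_ne_zero 2 hk0)]
    obtain ⟨n, t, hnt⟩ := v.exists_primeCompl_mul_eq_of_integer _ this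
    exact ⟨t, n, hnt⟩
  obtain ⟨t₁, n₁, e₁⟩ := key _ _ h10 h10
  obtain ⟨t₂, n₂, e₂⟩ := key _ _ h10 h11
  obtain ⟨t₃, n₃, e₃⟩ := key _ _ h11 h11
  obtain ⟨n, hn⟩ := hN h hh (h 0 0 ^ 2 * algebraMap R K ((t₁ * t₂ * t₃ : v.asIdeal.primeCompl) : R))
    ⟨n₁ * t₂ * t₃, by
      simp only [Submonoid.coe_mul, map_mul, ← e₁]; ring⟩
    ⟨n₂ * t₁ * t₃, by
      simp only [Submonoid.coe_mul, map_mul, ← e₂]; ring⟩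
    ⟨n₃ * t₁ * t₂, by
      simp only [Submonoid.coe_mul, map_mul, ← e₃]; ring⟩
  have ht : v.valuation K (algebraMap R K ((t₁ * t₂ * t₃ : v.asIdeal.primeCompl) : R)) = 1 := by
    rw [v.valuation_of_algebraMap, v.intValuation_eq_one_iff_mem_primeCompl]
    exact (t₁ * t₂ * t₃).2
  have h2 : v.valuation K (algebraMap R K n) ≤ 1 := v.valuation_le_one n
  rwa [hn, map_mul, map_mul, ht, mul_one, map_pow] at h2

/-- Let `R` be a Dedekind domain with fraction field `K`. A subgroup of `SL₂(K)` containing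
`SL₂(R)` equals `SL₂(R)` as soon as the squares of the ideals spanned by the bottom rows of its
elements all contain a common nonzero `N`. -/
theorem le_range_map_of_bottom_row {N : R} (hN0 : N ≠ 0)
    (hR : (map (n := Fin 2) (algebraMap R K)).range ≤ H)
    (hN : ∀ g ∈ H, ∀ s : K, s * g 1 0 ^ 2 ∈ (algebraMap R K).range →
      s * (g 1 0 * g 1 1) ∈ (algebraMap R K).range → s * g 1 1 ^ 2 ∈ (algebraMap R K).range →
      algebraMap R K N * s ∈ (algebraMap R K).range) {g : SL(2, K)} (hg : g ∈ H) (i j : Fin 2) :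
    g i j ∈ (algebraMap R K).range := by
  refine HeightOneSpectrum.mem_integers_of_valuation_le_one K _ fun v => ?_
  by_contra! h1
  have hv : v.valuation K (algebraMap R K N) ≠ 0 := by simpa using hN0
  -- The value group is archimedean, so corners of growing valuation eventually violate the bound
  -- coming from the fixed N.
  obtain ⟨n, hn⟩ := MulArchimedean.arch (v.valuation K (algebraMap R K N))⁻¹ h1
  obtain ⟨h, hh, k, l, hkl⟩ := exists_entry_pow_le H hR v hg h1 n
  have hgt : 1 < v.valuation K (h k l) := (one_lt_pow₀ h1 n.succ_ne_zero).trans_le hkl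
  obtain ⟨h', hh', hle, -, h10, h11⟩ := exists_small_bottom_row H hR v hh hgt
  have hk : 1 < v.valuation K (h' 0 0) := hgt.trans_le hle
  have hk0 : v.valuation K (h' 0 0) ≠ 0 := (zero_lt_one.trans hk).ne'
  have hb := valuation_mul_sq_le_one H hN v hh' hk0 h10 h11
  refine absurd hb (not_le.2 ?_)
  have h3 : (v.valuation K (algebraMap R K N))⁻¹ < v.valuation K (h' 0 0) ^ 2 := by
    calc _ ≤ v.valuation K (g i j) ^ n := hn
      _ < v.valuation K (g i j) ^ (n + 1) := pow_lt_pow_right₀ h1 n.lt_succ_self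
      _ ≤ v.valuation K (h' 0 0) := hkl.trans hle
      _ ≤ _ := le_self_pow₀ hk.le two_ne_zero
  calc (1 : _) = v.valuation K (algebraMap R K N) * (v.valuation K (algebraMap R K N))⁻¹ :=
        (mul_inv_cancel₀ hv).symm
    _ < _ := mul_lt_mul_of_pos_left h3 (zero_lt_iff.2 hv)

end Dedekind

/-! ### Translations in a discrete overgroup of Γ_K -/

/-- A discrete subgroup is closed, so this is a compact discrete set. -/
theorem finite_setOf_norm_entry_le (G : Subgroup SL(2, ℂ)) [DiscreteTopology G] (B : ℝ) :
    {g : SL(2, ℂ) | g ∈ G ∧ ∀ i j, ‖g i j‖ ≤ B}.Finite := by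
  have hcl : IsClosed (G : Set SL(2, ℂ)) := Subgroup.isClosed_of_discrete
  have hK : IsCompact {A : Matrix (Fin 2) (Fin 2) ℂ | ∀ i j, ‖A i j‖ ≤ B} := by
    have h := isCompact_univ_pi fun _ : Fin 2 => isCompact_univ_pi fun _ : Fin 2 =>
      isCompact_closedBall (0 : ℂ) B
    have h2 : {A : Matrix (Fin 2) (Fin 2) ℂ | ∀ i j, ‖A i j‖ ≤ B} =
        (Set.univ.pi fun _ => Set.univ.pi fun _ => Metric.closedBall (0 : ℂ) B :
          Set (Fin 2 → Fin 2 → ℂ)) :=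
      Set.ext fun A => ⟨fun hA i _ j _ => mem_closedBall_zero_iff.2 (hA i j),
        fun hA i j => mem_closedBall_zero_iff.1 (hA i trivial j trivial)⟩
    rw [h2]
    exact h
  have h1 := Matrix.SpecialLinearGroup.isClosedEmbedding_val.isCompact_preimage hK
  exact (h1.inter_left hcl).finite
    ((isDiscrete_iff_discreteTopology.2 ‹DiscreteTopology G›).mono Set.inter_subset_left)

theorem exists_intRing_norm_sub_le {m : ℕ} (hm : m ≠ 0) (z : ℂ) :
    ∃ w ∈ intRing m, ‖z - w‖ ≤ 1 + ‖sqrtNeg m‖ := by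
  have hs : Real.sqrt m ≠ 0 := by positivity
  refine ⟨(⌊z.re⌋ : ℂ) + (⌊z.im / Real.sqrt m⌋ : ℂ) * sqrtNeg m,
    add_mem (intCast_mem _ _) (mul_mem (intCast_mem _ _) (sqrtNeg_mem_intRing m)), ?_⟩
  have h1 : z - ((⌊z.re⌋ : ℂ) + (⌊z.im / Real.sqrt m⌋ : ℂ) * sqrtNeg m) =
      ((Int.fract z.re : ℝ) : ℂ) + ((Int.fract (z.im / Real.sqrt m) : ℝ) : ℂ) * sqrtNeg m := by
    apply Complex.ext
    · simp [sqrtNeg_re]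
    · simp [sqrtNeg_im]
      rw [← Int.self_sub_floor]
      field_simp
  rw [h1]
  refine (norm_add_le _ _).trans (add_le_add ?_ ?_)
  · rw [Complex.norm_real, Real.norm_of_nonneg (Int.fract_nonneg _)]
    exact (Int.fract_lt_one _).le
  · rw [norm_mul, Complex.norm_real, Real.norm_of_nonneg (Int.fract_nonneg _)]
    exact mul_le_of_le_one_left (norm_nonneg _) (Int.fract_lt_one _).le

theorem unipotent_mem_bianchiGroup {m : ℕ} {a c t : ℂ} (h1 : t * a ^ 2 ∈ intRing m)
    (h2 : t * (a * c) ∈ intRing m) (h3 : t * c ^ 2 ∈ intRing m) :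
    unipotent a c t ∈ bianchiGroup m := by
  rw [mem_bianchiGroup_iff]
  intro i j
  fin_cases i <;> fin_cases j
  · exact sub_mem (one_mem _) h2
  · exact h1
  · exact neg_mem h3
  · exact add_mem (one_mem _) h2

/-- The translations in a subgroup of `SL₂(ℂ)`. -/
def translationSubgroup (G : Subgroup SL(2, ℂ)) : AddSubgroup ℂ where
  carrier := {t | unipotent 1 0 t ∈ G}
  zero_mem' := by
    rw [Set.mem_ofPred_eq, unipotent_zero]; exact one_mem G
  add_mem' := by
    intro s t hs ht
    rw [Set.mem_ofPred_eq, unipotent_add]; exact mul_mem hs ht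
  neg_mem' := by
    intro t ht
    have h : unipotent 1 0 (-t) = (unipotent 1 0 t)⁻¹ := by
      rw [eq_inv_iff_mul_eq_one, ← unipotent_add, neg_add_cancel, unipotent_zero]
    rw [Set.mem_ofPred_eq, h]; exact inv_mem ht

theorem mem_translationSubgroup {G : Subgroup SL(2, ℂ)} {t : ℂ} :
    t ∈ translationSubgroup G ↔ unipotent 1 0 t ∈ G := Iff.rfl

theorem intRing_le_translationSubgroup {m : ℕ} {G : Subgroup SL(2, ℂ)}
    (hG : bianchiGroup m ≤ G) {t : ℂ} (ht : t ∈ intRing m) : t ∈ translationSubgroup G :=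
  hG (unipotent_mem_bianchiGroup (by simpa using ht) (by simp [zero_mem]) (by simp [zero_mem]))

/-- Every translation differs from one by an element of 𝓞_K by a bounded amount, and G has finitely
many bounded translations. So 𝓞_K has finite index among the translations, and N is this index. -/
theorem exists_nat_mul_translation_mem {m : ℕ} (hm : m ≠ 0) (G : Subgroup SL(2, ℂ))
    [DiscreteTopology G] (hG : bianchiGroup m ≤ G) :
    ∃ N : ℕ, N ≠ 0 ∧ ∀ t ∈ translationSubgroup G, (N : ℂ) * t ∈ intRing m := by
  let C : ℝ := 1 + ‖sqrtNeg m‖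
  let A := (intRing m).toAddSubgroup.addSubgroupOf (translationSubgroup G)
  have h1C : 1 ≤ C := le_add_of_nonneg_right (norm_nonneg _)
  have hF : {t : translationSubgroup G | ‖(t : ℂ)‖ ≤ C}.Finite := by
    have h1 := finite_setOf_norm_entry_le G C
    refine Set.Finite.of_injOn (f := fun t : translationSubgroup G => unipotent 1 0 (t : ℂ))
      ?_ ?_ h1
    · rintro t ht
      refine ⟨t.2, fun i j => ?_⟩
      have ht' : ‖(t : ℂ)‖ ≤ C := ht
      fin_cases i <;> fin_cases j <;> simp [coe_unipotent] <;>
        first | exact ht' | exact h1C | exact zero_le_one.trans h1C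
    · rintro s - t - hst
      apply Subtype.ext
      have := congrArg (fun g : SL(2, ℂ) => g 0 1) hst
      simpa [coe_unipotent] using this
  have hfin : Finite (translationSubgroup G ⧸ A) := by
    have := hF.to_subtype
    refine Finite.of_surjective
      (fun t : {t : translationSubgroup G | ‖(t : ℂ)‖ ≤ C} =>
        (QuotientAddGroup.mk (t : translationSubgroup G) : translationSubgroup G ⧸ A)) ?_
    intro q
    obtain ⟨t, rfl⟩ := QuotientAddGroup.mk_surjective q
    obtain ⟨w, hw, hle⟩ := exists_intRing_norm_sub_le hm (t : ℂ)
    let w' : translationSubgroup G := ⟨w, intRing_le_translationSubgroup hG hw⟩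
    refine ⟨⟨t - w', hle⟩, ?_⟩
    rw [QuotientAddGroup.eq]
    simp only [neg_sub, sub_add_cancel]
    exact hw
  refine ⟨A.index, AddSubgroup.index_ne_zero_of_finite, fun t ht => ?_⟩
  have h2 : A.index • (⟨t, ht⟩ : translationSubgroup G) ∈ A := A.nsmul_index_mem _
  rw [← nsmul_eq_mul]
  exact h2

/-- The vector (g₁₁, −g₁₀) is g⁻¹e₁, and the hypotheses put the unipotent fixing it with parameter s
into Γ_K. Its conjugate by g is the translation by s, an element of G. -/
theorem mul_translation_mem_of_bottom_row {m : ℕ} {G : Subgroup SL(2, ℂ)}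
    (hG : bianchiGroup m ≤ G) {N : ℕ}
    (hN : ∀ t ∈ translationSubgroup G, (N : ℂ) * t ∈ intRing m) {g : SL(2, ℂ)} (hg : g ∈ G)
    {s : ℂ} (h1 : s * g 1 0 ^ 2 ∈ intRing m) (h2 : s * (g 1 0 * g 1 1) ∈ intRing m)
    (h3 : s * g 1 1 ^ 2 ∈ intRing m) : (N : ℂ) * s ∈ intRing m := by
  apply hN
  have h4 : unipotent (g 1 1) (-g 1 0) s ∈ G := hG (unipotent_mem_bianchiGroup h3
    (by convert neg_mem h2 using 1; ring) (by convert h1 using 1; ring))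
  have h5 := mul_mem (mul_mem hg h4) (inv_mem hg)
  rw [mul_unipotent_mul_inv] at h5
  rw [mem_translationSubgroup]
  have e1 : g 0 0 * g 1 1 + g 0 1 * -g 1 0 = 1 := by linear_combination det_eq_one g
  have e2 : g 1 0 * g 1 1 + g 1 1 * -g 1 0 = 0 := by ring
  rwa [e1, e2] at h5

/-- Elements with entries in the field of a discrete group containing `SL₂(𝓞_K)` are integral. -/
theorem mem_bianchiGroup_of_discrete {m : ℕ} (hm : m ≠ 0) (G : Subgroup SL(2, ℂ))
    [DiscreteTopology G] (hG : bianchiGroup m ≤ G) {g : SL(2, ℂ)} (hg : g ∈ G)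
    (hK : ∀ i j, g i j ∈ imagQuadField m) : g ∈ bianchiGroup m := by
  obtain ⟨N, hN0, hN⟩ := exists_nat_mul_translation_mem hm G hG
  let φ := Matrix.SpecialLinearGroup.map (n := Fin 2) (algebraMap (imagQuadField m) ℂ)
  have hmem : ∀ x : imagQuadField m,
      x ∈ (algebraMap (𝓞 (imagQuadField m)) (imagQuadField m)).range ↔ (x : ℂ) ∈ intRing m := by
    intro x
    constructor
    · rintro ⟨y, rfl⟩
      exact ⟨y, rfl⟩
    · rintro ⟨y, hy⟩
      exact ⟨y, Subtype.ext hy⟩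
  let g' : SL(2, imagQuadField m) := ⟨Matrix.of fun i j => ⟨g i j, hK i j⟩, by
    apply Subtype.ext
    rw [Matrix.det_fin_two]
    exact det_eq_one g⟩
  have hg' : φ g' = g := by
    ext i j; rfl
  have hR : (Matrix.SpecialLinearGroup.map (n := Fin 2)
      (algebraMap (𝓞 (imagQuadField m)) (imagQuadField m))).range ≤ G.comap φ := by
    rintro _ ⟨y, rfl⟩
    exact hG ⟨y, by ext i j; rfl⟩
  rw [mem_bianchiGroup_iff]
  intro i j
  have h1 := le_range_map_of_bottom_row (R := 𝓞 (imagQuadField m)) (G.comap φ) (N := (N : 𝓞 _))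
    (by exact_mod_cast hN0) hR (fun h hh s h1 h2 h3 => by
      rw [hmem] at h1 h2 h3 ⊢
      have := mul_translation_mem_of_bottom_row hG hN hh (s := s) h1 h2 h3
      simpa using this) (g := g') (by rw [Subgroup.mem_comap, hg']; exact hg) i j
  rw [hmem] at h1
  exact h1

/-! ### Dirichlet approximation and rationality of columns -/

/-- Two real numbers in the same cell of the subdivision of `[-B, B]` into `k` equal cells are
close. -/
theorem abs_sub_le_of_floor_eq {x y B : ℝ} {k : ℕ} (hB : 0 < B) (hk : k ≠ 0) (hx : |x| ≤ B)
    (hy : |y| ≤ B) (h : ⌊(x + B) * k / (2 * B)⌋₊ = ⌊(y + B) * k / (2 * B)⌋₊) :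
    |x - y| ≤ 2 * B / k := by
  have hk' : (0 : ℝ) < k := by positivity
  have hx0 : 0 ≤ (x + B) * k / (2 * B) := by
    have := neg_le_of_abs_le hx
    have : 0 ≤ x + B := by linarith
    positivity
  have hy0 : 0 ≤ (y + B) * k / (2 * B) := by
    have := neg_le_of_abs_le hy
    have : 0 ≤ y + B := by linarith
    positivity
  have h1 : |(x + B) * k / (2 * B) - (y + B) * k / (2 * B)| ≤ 1 := by
    have a1 := Nat.floor_le hx0
    have a2 := Nat.lt_floor_add_one ((x + B) * k / (2 * B))
    have b1 := Nat.floor_le hy0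
    have b2 := Nat.lt_floor_add_one ((y + B) * k / (2 * B))
    rw [h] at a1 a2
    rw [abs_le]
    constructor <;> linarith
  have h2 : x - y = ((x + B) * k / (2 * B) - (y + B) * k / (2 * B)) * (2 * B / k) := by
    field_simp; ring
  rw [h2, abs_mul, abs_of_pos (show 0 < 2 * B / k by positivity)]
  exact mul_le_of_le_one_left (by positivity) h1

theorem floor_lt_of_abs_le {x B : ℝ} {k : ℕ} (hB : 0 < B) (hx : |x| ≤ B) :
    ⌊(x + B) * k / (2 * B)⌋₊ < k + 1 := by
  rw [Nat.lt_add_one_iff]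
  apply Nat.floor_le_of_le
  rw [div_le_iff₀ (by positivity)]
  have := le_of_abs_le hx
  have h2 : (x + B) ≤ 2 * B := by linarith
  calc _ ≤ 2 * B * (k : ℝ) := mul_le_mul_of_nonneg_right h2 (Nat.cast_nonneg k)
    _ = _ := by ring

/-- Dirichlet approximation by elements of `ℤ[√(-m)]`. -/
theorem exists_intRing_approx {m : ℕ} (hm : m ≠ 0) (a c : ℂ) :
    ∃ A B : ℝ, 0 < A ∧ 0 < B ∧ ∀ n : ℕ, n ≠ 0 → ∃ p ∈ intRing m, ∃ q ∈ intRing m,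
      (p ≠ 0 ∨ q ≠ 0) ∧ ‖p‖ ≤ A * n ∧ ‖q‖ ≤ A * n ∧ ‖p * a + q * c‖ ≤ B / n := by
  set s := sqrtNeg m with hs
  let A : ℝ := 1 + ‖s‖
  let R : ℝ := A * (‖a‖ + ‖c‖) + 1
  have hA : 0 < A := by positivity
  have hR : 0 < R := by positivity
  refine ⟨A, 4 * R, hA, by positivity, fun n hn => ?_⟩
  have hn' : (0 : ℝ) < n := by positivity
  let z : ℤ × ℤ → ℂ := fun k => (k.1 : ℂ) + (k.2 : ℂ) * s
  have hz : ∀ k, z k ∈ intRing m := fun k =>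
    add_mem (intCast_mem _ _) (mul_mem (intCast_mem _ _) (sqrtNeg_mem_intRing m))
  have hz0 : ∀ k, z k = 0 → k = 0 := by
    intro k hk
    have h1 := congrArg Complex.im hk
    have h2 := congrArg Complex.re hk
    simp [z, hs, sqrtNeg_im, sqrtNeg_re] at h1 h2
    exact Prod.ext h2 (h1.resolve_right hm)
  have hzsub : ∀ k l, z k - z l = z (k - l) := by
    intro k l; simp only [z, Prod.fst_sub, Prod.snd_sub]; push_cast; ring
  have hznorm : ∀ k : ℤ × ℤ, |(k.1 : ℝ)| ≤ n → |(k.2 : ℝ)| ≤ n → ‖z k‖ ≤ A * n := by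
    intro k h1 h2
    have e1 : ‖((k.1 : ℤ) : ℂ)‖ = |(k.1 : ℝ)| := Complex.norm_intCast _
    have e2 : ‖((k.2 : ℤ) : ℂ)‖ = |(k.2 : ℝ)| := Complex.norm_intCast _
    calc ‖z k‖ ≤ ‖((k.1 : ℤ) : ℂ)‖ + ‖((k.2 : ℤ) : ℂ)‖ * ‖s‖ := by
          rw [← norm_mul]; exact norm_add_le _ _
      _ ≤ n + n * ‖s‖ := by
          rw [e1, e2]; exact add_le_add h1 (mul_le_mul_of_nonneg_right h2 (norm_nonneg _))
      _ = A * n := by simp only [A]; ring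
  let I := Fin (n + 1) × Fin (n + 1)
  let ι : I → ℤ × ℤ := fun k => ((k.1 : ℕ), (k.2 : ℕ))
  have hιinj : Function.Injective ι := by
    rintro ⟨k1, k2⟩ ⟨l1, l2⟩ h
    simp only [ι, Prod.mk.injEq, Nat.cast_inj] at h
    exact Prod.ext (Fin.ext h.1) (Fin.ext h.2)
  have hfin : ∀ k l : Fin (n + 1), |((((k : ℕ) : ℤ) - ((l : ℕ) : ℤ) : ℤ) : ℝ)| ≤ n := by
    intro k l
    have hk := Nat.lt_succ_iff.1 k.2
    have hl := Nat.lt_succ_iff.1 l.2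
    have : |(((k : ℕ) : ℤ) - ((l : ℕ) : ℤ) : ℤ)| ≤ n := by rw [abs_le]; omega
    exact_mod_cast this
  have hιnorm : ∀ k l : I, ‖z (ι k) - z (ι l)‖ ≤ A * n := fun k l => by
    rw [hzsub]; exact hznorm _ (hfin _ _) (hfin _ _)
  have hιnorm0 : ∀ k : I, ‖z (ι k)‖ ≤ A * n := fun k => by
    have := hιnorm k 0
    simpa [z, ι] using this
  let f : I × I → ℂ := fun k => z (ι k.1) * a + z (ι k.2) * c
  have hf : ∀ k, ‖f k‖ ≤ R * n := by
    intro k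
    calc ‖f k‖ ≤ ‖z (ι k.1)‖ * ‖a‖ + ‖z (ι k.2)‖ * ‖c‖ := by
          rw [← norm_mul, ← norm_mul]; exact norm_add_le _ _
      _ ≤ A * n * ‖a‖ + A * n * ‖c‖ := by gcongr <;> exact hιnorm0 _
      _ ≤ R * n := by
          have : A * n * ‖a‖ + A * n * ‖c‖ = (A * (‖a‖ + ‖c‖)) * n := by ring
          rw [this]
          exact mul_le_mul_of_nonneg_right (by simp [R]) hn'.le
  have hRn : 0 < R * n := by positivity
  have hre : ∀ k, |(f k).re| ≤ R * n := fun k => (Complex.abs_re_le_norm _).trans (hf k)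
  have him : ∀ k, |(f k).im| ≤ R * n := fun k => (Complex.abs_im_le_norm _).trans (hf k)
  -- Pigeonhole: (n + 1)⁴ coefficient pairs against (n² + 1)² cells. A cell has side 2Rn/n² = 2R/n,
  -- and adding real and imaginary parts gives B = 4R.
  let cell : I × I → Fin (n ^ 2 + 1) × Fin (n ^ 2 + 1) := fun k =>
    (⟨⌊((f k).re + R * n) * (n ^ 2 : ℕ) / (2 * (R * n))⌋₊, floor_lt_of_abs_le hRn (hre k)⟩,
      ⟨⌊((f k).im + R * n) * (n ^ 2 : ℕ) / (2 * (R * n))⌋₊, floor_lt_of_abs_le hRn (him k)⟩)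
  obtain ⟨k, l, hkl, hcell⟩ := Fintype.exists_ne_map_eq_of_card_lt cell (by
    simp only [I, Fintype.card_prod, Fintype.card_fin]
    have h1 : n ^ 2 + 1 < (n + 1) * (n + 1) := by
      have := Nat.pos_of_ne_zero hn
      nlinarith
    exact Nat.mul_lt_mul'' h1 h1)
  have hn2 : n ^ 2 ≠ 0 := pow_ne_zero 2 hn
  have d1 := abs_sub_le_of_floor_eq hRn hn2 (hre k) (hre l)
    (congrArg (fun x => (x.1 : ℕ)) hcell)
  have d2 := abs_sub_le_of_floor_eq hRn hn2 (him k) (him l)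
    (congrArg (fun x => (x.2 : ℕ)) hcell)
  refine ⟨z (ι k.1) - z (ι l.1), sub_mem (hz _) (hz _), z (ι k.2) - z (ι l.2),
    sub_mem (hz _) (hz _), ?_, hιnorm _ _, hιnorm _ _, ?_⟩
  · by_contra! h
    apply hkl
    rw [hzsub, hzsub] at h
    exact Prod.ext (hιinj (sub_eq_zero.1 (hz0 _ h.1))) (hιinj (sub_eq_zero.1 (hz0 _ h.2)))
  · have e : (z (ι k.1) - z (ι l.1)) * a + (z (ι k.2) - z (ι l.2)) * c = f k - f l := by
      simp only [f]; ring
    rw [e]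
    refine (Complex.norm_le_abs_re_add_abs_im _).trans ?_
    rw [Complex.sub_re, Complex.sub_im]
    refine (add_le_add d1 d2).trans (le_of_eq ?_)
    push_cast
    field_simp
    ring

theorem weylElt_mem_bianchiGroup (m : ℕ) : weylElt ℂ ∈ bianchiGroup m := weylElt_mem_range

/-- In a discrete group containing `SL₂(𝓞_K)`, the ratio of the entries of a first column lies
in `ℙ¹(K)`. -/
theorem exists_column_relation {m : ℕ} (hm : m ≠ 0) (G : Subgroup SL(2, ℂ))
    [DiscreteTopology G] (hG : bianchiGroup m ≤ G) {g : SL(2, ℂ)} (hg : g ∈ G) :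
    ∃ p ∈ imagQuadField m, ∃ q ∈ imagQuadField m, (p ≠ 0 ∨ q ≠ 0) ∧
      p * g 0 0 + q * g 1 0 = 0 := by
  by_contra! hne
  set a := g 0 0 with ha
  set c := g 1 0 with hc
  obtain ⟨A, B, hA, hB, happ⟩ := exists_intRing_approx hm a c
  let C : ℝ := ‖a‖ + ‖c‖ + A * B
  let D : ℝ := 1 + C ^ 2
  -- On the unipotent with vector (x, y) and t = 1, ψ equals (cx − ay)². It measures how far the
  -- vector is from being proportional to (a, c).
  let ψ : SL(2, ℂ) → ℂ := fun h => c ^ 2 * h 0 1 - 2 * a * c * (1 - h 0 0) - a ^ 2 * h 1 0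
  let S : Set ℂ := ψ '' {h | h ∈ G ∧ ∀ i j, ‖h i j‖ ≤ D} \ {0}
  have hS : S.Finite := ((finite_setOf_norm_entry_le G D).image ψ).sdiff
  have h0 : (0 : ℂ) ∈ Sᶜ := fun h => h.2 rfl
  obtain ⟨ε, hε, hball⟩ := Metric.isOpen_iff.1 hS.isClosed.isOpen_compl 0 h0
  -- n > B makes ‖δ‖ ≤ 1, and n > B/ε then makes ‖δ‖⁴ ≤ ‖δ‖ < ε.
  obtain ⟨n, hn⟩ := exists_nat_gt (max 1 (max B (B / ε)))
  have hn1 : (1 : ℝ) < n := (le_max_left _ _).trans_lt hn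
  have hnB : B < n := ((le_max_left _ _).trans (le_max_right _ _)).trans_lt hn
  have hnε : B / ε < n := ((le_max_right _ _).trans (le_max_right _ _)).trans_lt hn
  have hn' : (0 : ℝ) < n := by linarith
  obtain ⟨p, hp, q, hq, hpq, hpn, hqn, hδ⟩ := happ n (by rintro rfl; simp at hn')
  set δ := p * a + q * c with hδdef
  have hδ0 : δ ≠ 0 := hne p (mem_intRing_iff.1 hp).1 q (mem_intRing_iff.1 hq).1 hpq
  -- This element of Γ_K moves (a, c) to (a + qδ, c − pδ), which stays bounded as n grows. On the
  -- resulting conjugate of the unit translation ψ takes the value δ⁴, nonzero but arbitrarily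
  -- small, although only finitely many values are available.
  have hu : unipotent (-q) p 1 * g ∈ G := mul_mem (hG (unipotent_mem_bianchiGroup
    (by rw [one_mul]; exact pow_mem (neg_mem hq) 2)
    (by rw [one_mul]; exact mul_mem (neg_mem hq) hp)
    (by rw [one_mul]; exact pow_mem hp 2))) hg
  have hT : unipotent 1 0 1 ∈ G := intRing_le_translationSubgroup hG (one_mem _)
  have hmem := mul_mem (mul_mem hu hT) (inv_mem hu)
  rw [mul_unipotent_mul_inv] at hmem
  have e1 : (unipotent (-q) p 1 * g) 0 0 * 1 + (unipotent (-q) p 1 * g) 0 1 * 0 = a + q * δ := by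
    simp [coe_unipotent, Matrix.mul_apply, Fin.sum_univ_two, hδdef, ← ha, ← hc]
    ring
  have e2 : (unipotent (-q) p 1 * g) 1 0 * 1 + (unipotent (-q) p 1 * g) 1 1 * 0 = c - p * δ := by
    simp [coe_unipotent, Matrix.mul_apply, Fin.sum_univ_two, hδdef, ← ha, ← hc]
    ring
  rw [e1, e2] at hmem
  have hbound : ∀ w : ℂ, ‖w‖ ≤ A * n → ‖w * δ‖ ≤ A * B := by
    intro w hw
    rw [norm_mul]
    calc _ ≤ A * n * (B / n) := mul_le_mul hw hδ (norm_nonneg _) (by positivity)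
      _ = A * B := by field_simp
  have hb1 : ‖a + q * δ‖ ≤ C := by
    refine (norm_add_le _ _).trans ?_
    have := hbound q hqn
    have := norm_nonneg c
    simp only [C]; linarith
  have hb2 : ‖c - p * δ‖ ≤ C := by
    refine (norm_sub_le _ _).trans ?_
    have := hbound p hpn
    have := norm_nonneg a
    simp only [C]; linarith
  have hC0 : 0 ≤ C := (norm_nonneg _).trans hb1
  have hψ : ψ (unipotent (a + q * δ) (c - p * δ) 1) = δ ^ 4 := by
    simp only [ψ, coe_unipotent]
    simp
    rw [hδdef]
    ring
  have hmemS : ψ (unipotent (a + q * δ) (c - p * δ) 1) ∈ S := by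
    refine ⟨⟨_, ⟨hmem, fun i j => ?_⟩, rfl⟩, ?_⟩
    · have h11 : ‖(a + q * δ) * (c - p * δ)‖ ≤ C ^ 2 := by
        rw [norm_mul, pow_two]; exact mul_le_mul hb1 hb2 (norm_nonneg _) hC0
      have h12 : ‖a + q * δ‖ ^ 2 ≤ C ^ 2 := pow_le_pow_left₀ (norm_nonneg _) hb1 2
      have h21 : ‖c - p * δ‖ ^ 2 ≤ C ^ 2 := pow_le_pow_left₀ (norm_nonneg _) hb2 2
      rw [coe_unipotent]
      fin_cases i <;> fin_cases j
      · refine (norm_sub_le _ _).trans ?_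
        rw [norm_one, one_mul]; exact add_le_add le_rfl h11
      · change ‖1 * (a + q * δ) ^ 2‖ ≤ D
        rw [one_mul, norm_pow]; simp only [D]; linarith
      · change ‖-(1 * (c - p * δ) ^ 2)‖ ≤ D
        rw [norm_neg, one_mul, norm_pow]; simp only [D]; linarith
      · refine (norm_add_le _ _).trans ?_
        rw [norm_one, one_mul]; exact add_le_add le_rfl h11
    · rw [Set.mem_singleton_iff, hψ]
      exact pow_ne_zero 4 hδ0
  refine hball ?_ hmemS
  rw [mem_ball_zero_iff, hψ, norm_pow]
  have hδ1 : ‖δ‖ ≤ 1 := hδ.trans ((div_le_one hn').2 hnB.le)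
  calc ‖δ‖ ^ 4 ≤ ‖δ‖ := pow_le_of_le_one (norm_nonneg _) hδ1 (by norm_num)
    _ ≤ B / n := hδ
    _ < ε := by rwa [div_lt_comm₀ hn' hε]

theorem exists_proportional {m : ℕ} {a c p q : ℂ} (hp : p ∈ imagQuadField m)
    (hq : q ∈ imagQuadField m) (hpq : p ≠ 0 ∨ q ≠ 0) (h : p * a + q * c = 0) :
    ∃ α : ℂ, ∃ x ∈ imagQuadField m, ∃ y ∈ imagQuadField m, a = α * x ∧ c = α * y := by
  by_cases hq0 : q = 0
  · have hp0 : p ≠ 0 := hpq.resolve_right (not_not.2 hq0)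
    refine ⟨-c / p, q, hq, -p, neg_mem hp, ?_, by field_simp⟩
    rw [hq0, zero_mul, add_zero] at h
    rw [hq0, mul_zero]
    exact (mul_eq_zero.1 h).resolve_left hp0
  · refine ⟨a / q, q, hq, -p, neg_mem hp, by field_simp, ?_⟩
    field_simp
    linear_combination h

/-- The column relation is used for both columns of g and for their sum. The columns are α and β
times vectors over K; the determinant gives αβ ∈ K and the sum gives α/β ∈ K, so α² and β² lie in K
as well. -/
theorem entry_mul_entry_mem {m : ℕ} (hm : m ≠ 0) (G : Subgroup SL(2, ℂ))
    [DiscreteTopology G] (hG : bianchiGroup m ≤ G) {g : SL(2, ℂ)} (hg : g ∈ G) (i j k l : Fin 2) :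
    g i j * g k l ∈ imagQuadField m := by
  have hW : weylElt ℂ ∈ G := hG (weylElt_mem_bianchiGroup m)
  have hL : unipotent 0 1 (-1) ∈ G := hG (unipotent_mem_bianchiGroup
    (by simp [zero_mem]) (by simp [zero_mem]) (by simp [one_mem]))
  obtain ⟨p₁, hp₁, q₁, hq₁, hpq₁, h₁⟩ := exists_column_relation hm G hG hg
  obtain ⟨p₂, hp₂, q₂, hq₂, hpq₂, h₂⟩ := exists_column_relation hm G hG (mul_mem hg hW)
  obtain ⟨p, hp, q, hq, hpq, h₃⟩ := exists_column_relation hm G hG (mul_mem hg hL)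
  have w0 : ∀ i, (g * weylElt ℂ) i 0 = g i 1 := fun i => by
    simp [coe_weylElt, Matrix.mul_apply, Fin.sum_univ_two]
  have l0 : ∀ i, (g * (unipotent 0 1 (-1) : SL(2, ℂ))) i 0 = g i 0 + g i 1 := fun i => by
    simp [coe_unipotent, Matrix.mul_apply, Fin.sum_univ_two]
  rw [w0, w0] at h₂
  rw [l0, l0] at h₃
  obtain ⟨α, x₁, hx₁, y₁, hy₁, ea, ec⟩ := exists_proportional hp₁ hq₁ hpq₁ h₁
  obtain ⟨β, x₂, hx₂, y₂, hy₂, eb, ed⟩ := exists_proportional hp₂ hq₂ hpq₂ h₂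
  have hdet := det_eq_one g
  rw [ea, eb, ec, ed] at hdet
  rw [ea, eb, ec, ed] at h₃
  have hΔ : α * β * (x₁ * y₂ - x₂ * y₁) = 1 := by linear_combination hdet
  have hα : α ≠ 0 := by rintro rfl; simp at hΔ
  have hβ : β ≠ 0 := by rintro rfl; simp at hΔ
  have hΔ0 : x₁ * y₂ - x₂ * y₁ ≠ 0 := by intro h; simp [h] at hΔ
  have hrel : α * (p * x₁ + q * y₁) + β * (p * x₂ + q * y₂) = 0 := by linear_combination h₃
  have hP : p * x₁ + q * y₁ ∈ imagQuadField m := add_mem (mul_mem hp hx₁) (mul_mem hq hy₁)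
  have hQ : p * x₂ + q * y₂ ∈ imagQuadField m := add_mem (mul_mem hp hx₂) (mul_mem hq hy₂)
  have hP0 : p * x₁ + q * y₁ ≠ 0 := by
    intro h
    rw [h, mul_zero, zero_add] at hrel
    have h' := (mul_eq_zero.1 hrel).resolve_left hβ
    have e1 : p * (x₁ * y₂ - x₂ * y₁) = 0 := by linear_combination y₂ * h - y₁ * h'
    have e2 : q * (x₁ * y₂ - x₂ * y₁) = 0 := by linear_combination x₁ * h' - x₂ * h
    rcases hpq with h0 | h0
    · exact h0 ((mul_eq_zero.1 e1).resolve_right hΔ0)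
    · exact h0 ((mul_eq_zero.1 e2).resolve_right hΔ0)
  have hQ0 : p * x₂ + q * y₂ ≠ 0 := by
    intro h
    rw [h, mul_zero, add_zero] at hrel
    exact hP0 ((mul_eq_zero.1 hrel).resolve_left hα)
  have hαβ : α * β ∈ imagQuadField m := by
    rw [eq_inv_of_mul_eq_one_left hΔ]
    exact inv_mem (sub_mem (mul_mem hx₁ hy₂) (mul_mem hx₂ hy₁))
  have hαα : α * α ∈ imagQuadField m := by
    have : α * α = -(α * β * (p * x₂ + q * y₂) / (p * x₁ + q * y₁)) := by
      field_simp
      linear_combination hrel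
    rw [this]
    exact neg_mem (div_mem (mul_mem hαβ hQ) hP)
  have hββ : β * β ∈ imagQuadField m := by
    have : β * β = (α * β) * (α * β) / (α * α) := by field_simp
    rw [this]
    exact div_mem (mul_mem hαβ hαβ) hαα
  have hcol : ∀ i j, ∃ t, (t = α ∨ t = β) ∧ ∃ x ∈ imagQuadField m, g i j = t * x := by
    intro i j
    fin_cases i <;> fin_cases j
    · exact ⟨α, .inl rfl, x₁, hx₁, ea⟩
    · exact ⟨β, .inr rfl, x₂, hx₂, eb⟩
    · exact ⟨α, .inl rfl, y₁, hy₁, ec⟩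
    · exact ⟨β, .inr rfl, y₂, hy₂, ed⟩
  obtain ⟨t, ht, x, hx, e⟩ := hcol i j
  obtain ⟨t', ht', x', hx', e'⟩ := hcol k l
  rw [e, e', mul_mul_mul_comm]
  refine mul_mem ?_ (mul_mem hx hx')
  rcases ht with rfl | rfl <;> rcases ht' with rfl | rfl
  · exact hαα
  · exact hαβ
  · rw [mul_comm]; exact hαβ
  · exact hββ

/-! ### Maximality and conclusion -/

theorem le_integralProductGroup_of_discrete {m : ℕ} (hm : m ≠ 0) (G : Subgroup SL(2, ℂ))
    [DiscreteTopology G] (hG : bianchiGroup m ≤ G) : G ≤ integralProductGroup m := by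
  have hcol : ∀ g ∈ G, ∀ i, g i 0 ^ 2 ∈ intRing m := by
    intro g hg
    have hT : unipotent 1 0 1 ∈ G := intRing_le_translationSubgroup hG (one_mem _)
    -- With first column (a, c) of g, this conjugate has entries 1 ∓ ac, a² and −c², all in K, so it
    -- is integral even though g itself need not have entries in K.
    have hmem := mul_mem (mul_mem hg hT) (inv_mem hg)
    rw [mul_unipotent_mul_inv] at hmem
    simp only [mul_one, mul_zero, add_zero] at hmem
    have hprod := entry_mul_entry_mem hm G hG hg
    have hsq : ∀ i, g i 0 ^ 2 ∈ imagQuadField m := fun i => by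
      rw [pow_two]; exact hprod i 0 i 0
    have h1 := mem_bianchiGroup_iff.1 (mem_bianchiGroup_of_discrete hm G hG hmem (by
      intro i j
      rw [coe_unipotent]
      simp only [one_mul]
      fin_cases i <;> fin_cases j
      · exact sub_mem (one_mem _) (hprod 0 0 1 0)
      · exact hsq 0
      · exact neg_mem (hsq 1)
      · exact add_mem (one_mem _) (hprod 0 0 1 0)))
    intro i
    fin_cases i
    · have := h1 0 1
      simpa [coe_unipotent] using this
    · have := neg_mem (h1 1 0)
      simpa [coe_unipotent] using this
  intro g hg
  refine mem_integralProductGroup_of_sq (entry_mul_entry_mem hm G hG hg) fun i j => ?_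
  fin_cases j
  · exact hcol g hg i
  · have hW : weylElt ℂ ∈ G := hG (weylElt_mem_bianchiGroup m)
    have := hcol _ (mul_mem hg hW) i
    simpa [coe_weylElt, Matrix.mul_apply, Fin.sum_univ_two] using this

theorem isMaximalDiscreteExtension_integralProductGroup {m : ℕ} (hm : m ≠ 0) :
    IsMaximalDiscreteExtension (bianchiGroup m) (integralProductGroup m) := by
  refine ⟨⟨bianchiGroup_le_integralProductGroup m, discreteTopology_integralProductGroup hm⟩, ?_⟩
  rintro G ⟨hG, hdisc⟩
  exact le_integralProductGroup_of_discrete hm G hG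

theorem theorem1 (m : ℕ) (hm : Squarefree m) :
    ∃ Γstar : Subgroup SL(2, ℂ),
      IsMaximalDiscreteExtension (bianchiGroup m) Γstar ∧
      (∀ d : SqfreeDiscrDivisor m, ∃ u v : ℤ, IsBezoutPair m d u v) ∧
      ∀ (u v : SqfreeDiscrDivisor m → ℤ) (h : ∀ d : SqfreeDiscrDivisor m, IsBezoutPair m d (u d) (v d)),
        (Γstar : Set SL(2, ℂ)) =
          ⋃ d : SqfreeDiscrDivisor m,
            (fun γ => γ * atkinLehner m d (u d) (v d) d.2.1.ne_zero (h d)) ''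
              (bianchiGroup m : Set SL(2, ℂ)) :=
  ⟨integralProductGroup m, isMaximalDiscreteExtension_integralProductGroup hm.ne_zero,
    fun d => exists_isBezoutPair hm d.2.1 d.2.2,
    fun u v h => integralProductGroup_eq_iUnion hm.ne_zero u v h⟩
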